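/- A PROP is a strict symmetric monoidal category whose objects are the natural numbers, with $\otimes$ given by addition on objects; a $\dagger$-PROP is a PROP with an involutive, identity-on-objects, contravariant strict monoidal functor $\dagger$ for which the symmetries are unitary. Let $G$ and $H$ be abelian groups. Let $\mathbf{IF}(G,H)$ be the $\dagger$-PROP presented as follows. The generators are, for each colour $c\in\{g,r\}$ (green, red), $\mu_c:2\to1$, $\eta_c:0\to1$, $\delta_c=\mu_c^\dagger:1\to2$, $\epsilon_c=\eta_c^\dagger:1\to0$, together with a green phase $\alpha:1\to1$ for every $\alpha\in G$ and a red phase $\beta:1\to1$ for every $\beta\in H$, where $\alpha^\dagger=\alpha^{-1}$ and $\beta^\dagger=\beta^{-1}$. The equations are the following and their images under $\dagger$ (here $1$ also denotes the identity of the object $1$, and $\sigma:2\to2$ is the symmetry): 1. for each colour $c$, $(\mu_c,\eta_c,\delta_c,\epsilon_c)$ is a special commutative Frobenius algebra: $(\mu_c,\eta_c)$ is a commutative monoid, $(1\otimes\mu_c)(\delta_c\otimes1)=\delta_c\mu_c=(\mu_c\otimes1)(1\otimes\delta_c)$ and $\mu_c\delta_c=1$; 2. phases of the same colour $c$ compose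 as in the corresponding group (in particular the neutral element is the identity), and $\mu_c(\alpha\otimes\alpha')=(\alpha\alpha')\mu_c$ for phases $\alpha,\alpha'$ of colour $c$; 3. $(\mu_r,\eta_r,\delta_g,\epsilon_g)$ is a bialgebra: $\delta_g\mu_r=(\mu_r\otimes\mu_r)(1\otimes\sigma\otimes1)(\delta_g\otimes\delta_g)$, $\delta_g\eta_r=\eta_r\otimes\eta_r$, $\epsilon_g\mu_r=\epsilon_g\otimes\epsilon_g$, $\epsilon_g\eta_r=\mathrm{id}_0$; 4. $\epsilon_r\mu_r(\eta_g\otimes1)=\epsilon_g$ and $(\epsilon_r\otimes1)\delta_g\eta_g=\eta_r$. Put $s=(\epsilon_g\mu_g\otimes1)(1\otimes\delta_r\eta_r):1\to1$. Let $\mathbf{HA}$ be the sub-PROP of $\mathbf{IF}(G,H)$ generated by $\delta_g,\epsilon_g,\mu_r,\eta_r$ and $s$ (the smallest class of morphisms that contains these, the identities and the symmetries, and is closed under composition and $\otimes$), and let $\mathbf{HA}^{\mathrm{op}}$ be, dually, the sub-PROP generated by $\delta_r,\epsilon_r,\mu_g,\eta_g$ and $s^\dagger$. **Theorem.** Let $f:n\to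 m$ be an invertible morphism of $\mathbf{IF}(G,H)$. Then $f$ lies in $\mathbf{HA}$ if and only if $f$ lies in $\mathbf{HA}^{\mathrm{op}}$. -/

import Mathlib

open CategoryTheory

namespace InteractingFrobenius

/-- The two colours of Frobenius algebra. -/
inductive Colour
  | green
  | red

/-- The generators, beyond the symmetric monoidal structure: for each colour a multiplication,
a unit, a comultiplication and a counit, together with a green phase for each element of `G` and
a red phase for each element of `H`. -/
inductive Gen (G H : Type*) : ℕ → ℕ → Type _
  | mu (c : Colour) : Gen G H 2 1
  | eta (c : Colour) : Gen G H 0 1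
  | delta (c : Colour) : Gen G H 1 2
  | eps (c : Colour) : Gen G H 1 0
  | greenPhase (g : G) : Gen G H 1 1
  | redPhase (h : H) : Gen G H 1 1

/-- Formal terms `m → n`, built from the generators by composition and tensor, with identities
and symmetries. -/
inductive Term (G H : Type*) : ℕ → ℕ → Type _
  | gen {m n : ℕ} (x : Gen G H m n) : Term G H m n
  | idn (n : ℕ) : Term G H n n
  | swap (m n : ℕ) : Term G H (m + n) (n + m)
  | comp {l m n : ℕ} (f : Term G H l m) (g : Term G H m n) : Term G H l n
  | tensor {m n m' n' : ℕ} (f : Term G H m n) (g : Term G H m' n') :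
      Term G H (m + m') (n + n')

/-- Composition of terms in diagrammatic order: `f ⨾ g` is `f` followed by `g`. -/
infixr:80 " ⨾ " => Term.comp

/-- Tensor product of terms. -/
infixr:90 " ⊠ " => Term.tensor

namespace Term

variable {G H : Type*}

/-- Transport of a term along equalities of its source and target. -/
def cast {m n m' n' : ℕ} (hm : m = m') (hn : n = n') (f : Term G H m n) : Term G H m' n' :=
  hm ▸ hn ▸ f

/-- Multiplication of the given colour. -/
abbrev mu (c : Colour) : Term G H 2 1 := gen (Gen.mu c)

/-- Unit of the given colour. -/
abbrev eta (c : Colour) : Term G H 0 1 := gen (Gen.eta c)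

/-- Comultiplication of the given colour. -/
abbrev delta (c : Colour) : Term G H 1 2 := gen (Gen.delta c)

/-- Counit of the given colour. -/
abbrev eps (c : Colour) : Term G H 1 0 := gen (Gen.eps c)

/-- The green phase given by `g`. -/
abbrev greenPhase (g : G) : Term G H 1 1 := gen (Gen.greenPhase g)

/-- The red phase given by `h`. -/
abbrev redPhase (h : H) : Term G H 1 1 := gen (Gen.redPhase h)

/-- The cup `0 → 2` of the given colour. -/
abbrev cup (c : Colour) : Term G H 0 2 := eta c ⨾ delta c

/-- The cap `2 → 0` of the given colour. -/
abbrev cap (c : Colour) : Term G H 2 0 := mu c ⨾ eps c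

/-- The exchange of the two middle wires out of four. -/
abbrev middleSwap : Term G H 4 4 :=
  (idn 1 ⊠ (swap 1 1 ⊠ idn 1) : Term G H (1 + ((1 + 1) + 1)) (1 + ((1 + 1) + 1)))

/-- The antipode: a green cap joined to a red cup. -/
abbrev antipode : Term G H 1 1 :=
  (idn 1 ⊠ cup Colour.red) ⨾ (cap Colour.green ⊠ idn 1)

end Term

/-- The dagger of a generator. -/
def Gen.dagger {G H : Type*} [CommGroup G] [CommGroup H] :
    {m n : ℕ} → Gen G H m n → Gen G H n m
  | _, _, .mu c => .delta c
  | _, _, .eta c => .eps c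
  | _, _, .delta c => .mu c
  | _, _, .eps c => .eta c
  | _, _, .greenPhase g => .greenPhase g⁻¹
  | _, _, .redPhase h => .redPhase h⁻¹

/-- The dagger of a term. -/
def Term.dagger {G H : Type*} [CommGroup G] [CommGroup H] :
    {m n : ℕ} → Term G H m n → Term G H n m
  | _, _, .gen x => .gen x.dagger
  | _, _, .idn n => .idn n
  | _, _, .swap m n => .swap n m
  | _, _, .comp f g => .comp g.dagger f.dagger
  | _, _, .tensor f g => .tensor f.dagger g.dagger

open Term Colour in
/-- The least congruence on terms which is compatible with the dagger, contains the laws of strict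
symmetric monoidal categories, the laws of a special commutative dagger-Frobenius algebra with
phase group `G` (green) respectively `H` (red), and the laws governing the interaction of the two
colours. Since it is compatible with the dagger, the dual of each law holds as well. -/
inductive Eqv (G H : Type*) [CommGroup G] [CommGroup H] :
    {m n : ℕ} → Term G H m n → Term G H m n → Prop
  -- congruence
  | refl {m n : ℕ} (f : Term G H m n) : Eqv G H f f
  | symm {m n : ℕ} {f g : Term G H m n} : Eqv G H f g → Eqv G H g f
  | trans {m n : ℕ} {f g h : Term G H m n} : Eqv G H f g → Eqv G H g h → Eqv G H f h
  | comp_congr {l m n : ℕ} {f f' : Term G H l m} {g g' : Term G H m n} :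
      Eqv G H f f' → Eqv G H g g' → Eqv G H (f ⨾ g) (f' ⨾ g')
  | tensor_congr {m n m' n' : ℕ} {f f' : Term G H m n} {g g' : Term G H m' n'} :
      Eqv G H f f' → Eqv G H g g' → Eqv G H (f ⊠ g) (f' ⊠ g')
  | dagger_congr {m n : ℕ} {f g : Term G H m n} : Eqv G H f g → Eqv G H f.dagger g.dagger
  -- category
  | id_comp {m n : ℕ} (f : Term G H m n) : Eqv G H (idn m ⨾ f) f
  | comp_id {m n : ℕ} (f : Term G H m n) : Eqv G H (f ⨾ idn n) f
  | comp_assoc {k l m n : ℕ} (f : Term G H k l) (g : Term G H l m) (h : Term G H m n) :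
      Eqv G H ((f ⨾ g) ⨾ h) (f ⨾ (g ⨾ h))
  -- strict monoidal structure
  | id_tensor_id (m n : ℕ) : Eqv G H (idn m ⊠ idn n) (idn (m + n))
  | interchange {l m n l' m' n' : ℕ} (f : Term G H l m) (g : Term G H m n)
      (f' : Term G H l' m') (g' : Term G H m' n') :
      Eqv G H ((f ⨾ g) ⊠ (f' ⨾ g')) ((f ⊠ f') ⨾ (g ⊠ g'))
  | tensor_assoc {m n m' n' m'' n'' : ℕ} (f : Term G H m n) (g : Term G H m' n')
      (h : Term G H m'' n'') :
      Eqv G H (Term.cast (Nat.add_assoc _ _ _) (Nat.add_assoc _ _ _) ((f ⊠ g) ⊠ h))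
        (f ⊠ (g ⊠ h))
  | unit_tensor {m n : ℕ} (f : Term G H m n) :
      Eqv G H (Term.cast (Nat.zero_add _) (Nat.zero_add _) (idn 0 ⊠ f)) f
  | tensor_unit {m n : ℕ} (f : Term G H m n) :
      Eqv G H (Term.cast (Nat.add_zero _) (Nat.add_zero _) (f ⊠ idn 0)) f
  -- symmetry
  | swap_natural {m n m' n' : ℕ} (f : Term G H m n) (g : Term G H m' n') :
      Eqv G H ((f ⊠ g) ⨾ swap n n') (swap m m' ⨾ (g ⊠ f))
  | swap_swap (m n : ℕ) : Eqv G H (swap m n ⨾ swap n m) (idn (m + n))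
  | hexagon (l m n : ℕ) :
      Eqv G H (swap l (m + n))
        (Term.cast (Nat.add_assoc l m n) (Nat.add_assoc m n l).symm
          ((swap l m ⊠ idn n) ⨾
            Term.cast (Nat.add_assoc m l n).symm rfl (idn m ⊠ swap l n)))
  | swap_unit (n : ℕ) :
      Eqv G H (Term.cast (Nat.add_zero n) (Nat.zero_add n) (swap n 0)) (idn n)
  -- commutative monoid, in each colour
  | mu_assoc (c : Colour) :
      Eqv G H (m := 3) (n := 1)
        ((mu c ⊠ idn 1) ⨾ mu c) ((idn 1 ⊠ mu c) ⨾ mu c)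
  | mu_unit (c : Colour) : Eqv G H ((eta c ⊠ idn 1) ⨾ mu c) (idn 1)
  | mu_comm (c : Colour) : Eqv G H (swap 1 1 ⨾ mu c) (mu c)
  -- special Frobenius algebra, in each colour
  | frobenius_left (c : Colour) :
      Eqv G H (m := 2) (n := 2) ((delta c ⊠ idn 1) ⨾ (idn 1 ⊠ mu c)) (mu c ⨾ delta c)
  | frobenius_right (c : Colour) :
      Eqv G H (m := 2) (n := 2) ((idn 1 ⊠ delta c) ⨾ (mu c ⊠ idn 1)) (mu c ⨾ delta c)
  | special (c : Colour) : Eqv G H (delta c ⨾ mu c) (idn 1)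
  -- the phases of each colour form the given group, and commute with the multiplication
  | green_one : Eqv G H (greenPhase 1) (idn 1)
  | green_mul (g g' : G) : Eqv G H (greenPhase g ⨾ greenPhase g') (greenPhase (g' * g))
  | green_mu (g g' : G) :
      Eqv G H (m := 2) (n := 1)
        ((greenPhase g ⊠ greenPhase g') ⨾ mu green) (mu green ⨾ greenPhase (g * g'))
  | red_one : Eqv G H (redPhase 1) (idn 1)
  | red_mul (h h' : H) : Eqv G H (redPhase h ⨾ redPhase h') (redPhase (h' * h))
  | red_mu (h h' : H) :
      Eqv G H (m := 2) (n := 1)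
        ((redPhase h ⊠ redPhase h') ⨾ mu red) (mu red ⨾ redPhase (h * h'))
  -- bialgebra: green comultiplication against red multiplication
  | bialgebra :
      Eqv G H (m := 2) (n := 2) (mu red ⨾ delta green)
        ((delta green ⊠ delta green) ⨾ middleSwap ⨾ (mu red ⊠ mu red))
  | copy : Eqv G H (m := 0) (n := 2) (eta red ⨾ delta green) (eta red ⊠ eta red)
  | cocopy : Eqv G H (m := 2) (n := 0) (mu red ⨾ eps green) (eps green ⊠ eps green)
  | bone : Eqv G H (eta red ⨾ eps green) (idn 0)
  -- the green counit is the red transpose of the green unit, and the red unit is the green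
  -- transpose of the red counit
  | green_unit_real : Eqv G H ((eta green ⊠ idn 1) ⨾ cap red) (eps green)
  | red_unit_real : Eqv G H (cup green ⨾ (eps red ⊠ idn 1)) (eta red)

/-- Terms up to the congruence. -/
instance termSetoid (G H : Type*) [CommGroup G] [CommGroup H] (m n : ℕ) :
    Setoid (Term G H m n) where
  r := Eqv G H
  iseqv := ⟨Eqv.refl, Eqv.symm, Eqv.trans⟩

/-- The PROP of interacting Frobenius algebras with phase groups `G` (green) and `H` (red). Its
objects are the natural numbers. -/
@[ext]
structure IF (G H : Type*) where
  /-- The number of wires. -/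
  wires : ℕ

namespace IF

variable {G H : Type*} [CommGroup G] [CommGroup H]

/-- Morphisms are terms up to the congruence. -/
instance : Category (IF G H) where
  Hom X Y := Quotient (termSetoid G H X.wires Y.wires)
  id X := Quotient.mk _ (Term.idn X.wires)
  comp f g := Quotient.map₂ Term.comp (fun _ _ h _ _ h' => Eqv.comp_congr h h') f g
  id_comp f := Quotient.inductionOn f fun f => Quotient.sound (Eqv.id_comp f)
  comp_id f := Quotient.inductionOn f fun f => Quotient.sound (Eqv.comp_id f)
  assoc f g h := Quotient.inductionOn₃ f g h fun f g h => Quotient.sound (Eqv.comp_assoc f g h)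

/-- The morphism represented by a term. -/
def ofTerm {m n : ℕ} (t : Term G H m n) : (⟨m⟩ : IF G H) ⟶ ⟨n⟩ :=
  Quotient.mk (termSetoid G H m n) t

/-- The tensor product of morphisms. -/
def tensor {m n m' n' : ℕ} (f : (⟨m⟩ : IF G H) ⟶ ⟨n⟩) (g : (⟨m'⟩ : IF G H) ⟶ ⟨n'⟩) :
    (⟨m + m'⟩ : IF G H) ⟶ ⟨n + n'⟩ :=
  Quotient.map₂ (sa := termSetoid G H m n) (sb := termSetoid G H m' n')
    (sc := termSetoid G H (m + m') (n + n'))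
    Term.tensor (fun _ _ h _ _ h' => Eqv.tensor_congr h h') f g

/-- The dagger of a morphism. -/
def dagger {X Y : IF G H} (f : X ⟶ Y) : Y ⟶ X :=
  Quotient.map (sa := termSetoid G H X.wires Y.wires) (sb := termSetoid G H Y.wires X.wires)
    Term.dagger (fun _ _ h => Eqv.dagger_congr h) f

/-- The sub-PROP generated by a family of morphisms: its closure under identities, symmetries,
composition and tensor. -/
inductive Generated (S : MorphismProperty (IF G H)) : MorphismProperty (IF G H)
  | of {X Y : IF G H} (f : X ⟶ Y) : S f → Generated S f
  | id (X : IF G H) : Generated S (𝟙 X)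
  | swap (m n : ℕ) : Generated S (ofTerm (Term.swap m n))
  | comp {X Y Z : IF G H} (f : X ⟶ Y) (g : Y ⟶ Z) :
      Generated S f → Generated S g → Generated S (f ≫ g)
  | tensor {m n m' n' : ℕ} (f : (⟨m⟩ : IF G H) ⟶ ⟨n⟩) (g : (⟨m'⟩ : IF G H) ⟶ ⟨n'⟩) :
      Generated S f → Generated S g → Generated S (tensor f g)

open Colour in
/-- The bialgebra of the green comonoid and the red monoid, with the antipode. -/
inductive HAGen : MorphismProperty (IF G H)
  | delta : HAGen (ofTerm (Term.delta green))
  | eps : HAGen (ofTerm (Term.eps green))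
  | mu : HAGen (ofTerm (Term.mu red))
  | eta : HAGen (ofTerm (Term.eta red))
  | antipode : HAGen (ofTerm Term.antipode)

open Colour in
/-- The opposite bialgebra of the red comonoid and the green monoid, with the dagger of the
antipode. -/
inductive HAOpGen : MorphismProperty (IF G H)
  | delta : HAOpGen (ofTerm (Term.delta red))
  | eps : HAOpGen (ofTerm (Term.eps red))
  | mu : HAOpGen (ofTerm (Term.mu green))
  | eta : HAOpGen (ofTerm (Term.eta green))
  | antipode : HAOpGen (dagger (ofTerm Term.antipode))

/-- The sub-PROP of morphisms generated by the Hopf algebra of the green comonoid and the red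
monoid. -/
def HA : MorphismProperty (IF G H) := Generated HAGen

/-- The sub-PROP of morphisms generated by the opposite Hopf algebra, that of the red comonoid and
the green monoid. -/
def HAOp : MorphismProperty (IF G H) := Generated HAOpGen

end IF

end InteractingFrobenius

/-!
Every morphism of the Hopf algebra `HA` acts on tuples of points as an integer matrix, is determined
by that matrix, and denotes the graph of that matrix in a model of the theory. An invertible
morphism therefore has an invertible integer matrix, and invertible integer matrices are products of
elementary ones, each of which is already realised by a morphism of `HAOp`.

In detail, `IF G H` is a symmetric monoidal category in the sense of Mathlib, and one wire carries a
commutative and cocommutative Hopf monoid with the green comonoid, the red monoid and, as antipode,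
the dagger of `Term.antipode` (`hopf_law`). For a cocommutative comonoid `K` the comonoid morphisms
from `K` to the wire form an abelian group under convolution, here `Points K (wire G H)`. A tuple
of `n` points gives a morphism `tuple p : K ⟶ n`, and composing it with a morphism of `HA`
transforms the tuple by an integer matrix (`Represents`). For a suitable `K` there is a tuple with
`tuple p` invertible (`exists_tuple_isIso`), so the matrix determines the morphism.

The relational model labels wires by integers: green structure copies labels, red structure adds
them. It is sound (`Eqv.rel`) and sends a morphism of `HA` to the graph of its matrix
(`exists_matrix`), so the matrix of an invertible morphism is bijective on integer vectors. In
particular source and target agree and the matrix is invertible over `ℤ`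
(`bijective_act_of_isGraph`).

By Euclid's algorithm, invertible integer matrices are generated, using products and block sums, by
the sign, the swap and one shear (`GeneratingFamily.mem_of_isUnit`). The swap lies in `HAOp` by
definition. The sign is the antipode: it is inverted by its dagger because of the snake equations,
and it is an involution because it is the inversion of a group, so it equals its dagger, a generator
of `HAOp` (`ofTerm_antipode`). The shear `(a, b) ↦ (a, b - a)` lies in `HAOp` because the antipode
is a bent wire: straightening it turns green comultiplication and red multiplication into red
comultiplication and green multiplication (`subShear_eq`). Hence `HAOp` contains every invertible
morphism of `HA`, and the converse follows by applying the dagger.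
-/

namespace InteractingFrobenius

open MonoidalCategory

namespace IF

variable {G H : Type*} [CommGroup G] [CommGroup H]

/-! ### The symmetric monoidal category of interacting Frobenius algebras -/

theorem sound {m n : ℕ} {s t : Term G H m n} (h : Eqv G H s t) : ofTerm s = ofTerm t :=
  Quotient.sound h

theorem ofTerm_surjective {m n : ℕ} (f : (⟨m⟩ : IF G H) ⟶ ⟨n⟩) : ∃ t, ofTerm t = f :=
  Quotient.exists_rep f

theorem ofTerm_comp {l m n : ℕ} (s : Term G H l m) (t : Term G H m n) :
    ofTerm (s ⨾ t) = ofTerm s ≫ ofTerm t := rfl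

/-- A transport of a term along equalities of arities is conjugation by `eqToHom`. -/
theorem ofTerm_cast {m n m' n' : ℕ} (hm : m = m') (hn : n = n') (t : Term G H m n) :
    ofTerm (t.cast hm hn) =
      eqToHom (congrArg IF.mk hm.symm) ≫ ofTerm t ≫ eqToHom (congrArg IF.mk hn) := by
  subst hm hn
  simp [Term.cast]

/-- The monoidal structure is strict, but Mathlib's monoidal categories are not: the associators and
unitors are the transports along the laws of addition. -/
instance : MonoidalCategoryStruct (IF G H) where
  tensorObj X Y := ⟨X.wires + Y.wires⟩
  whiskerLeft X _ _ f := tensor (𝟙 X) f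
  whiskerRight f Y := tensor f (𝟙 Y)
  tensorHom f g := tensor f g
  tensorUnit := ⟨0⟩
  associator X Y Z := eqToIso (congrArg IF.mk (Nat.add_assoc X.wires Y.wires Z.wires))
  leftUnitor X := eqToIso (congrArg IF.mk (Nat.zero_add X.wires))
  rightUnitor X := eqToIso (congrArg IF.mk (Nat.add_zero X.wires))

theorem ofTerm_tensor {m n m' n' : ℕ} (s : Term G H m n) (t : Term G H m' n') :
    ofTerm (s ⊠ t) = ofTerm s ⊗ₘ ofTerm t := rfl

theorem associator_eq (X Y Z : IF G H) :
    α_ X Y Z = eqToIso (congrArg IF.mk (Nat.add_assoc X.wires Y.wires Z.wires)) := rfl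

theorem leftUnitor_eq (X : IF G H) : λ_ X = eqToIso (congrArg IF.mk (Nat.zero_add X.wires)) := rfl

theorem rightUnitor_eq (X : IF G H) : ρ_ X = eqToIso (congrArg IF.mk (Nat.add_zero X.wires)) := rfl

theorem id_tensorHom_id (X Y : IF G H) : 𝟙 X ⊗ₘ 𝟙 Y = 𝟙 (X ⊗ Y) :=
  sound (Eqv.id_tensor_id X.wires Y.wires)

theorem eqToHom_tensorHom_eqToHom {X Y X' Y' : IF G H} (h : X = Y) (h' : X' = Y') :
    eqToHom h ⊗ₘ eqToHom h' = eqToHom (by rw [h, h']) := by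
  subst h h'
  exact id_tensorHom_id _ _

theorem eqToHom_tensorHom_id {X Y : IF G H} (h : X = Y) (Z : IF G H) :
    eqToHom h ⊗ₘ 𝟙 Z = eqToHom (by rw [h]) :=
  eqToHom_tensorHom_eqToHom h rfl

theorem id_tensorHom_eqToHom {X Y : IF G H} (Z : IF G H) (h : X = Y) :
    𝟙 Z ⊗ₘ eqToHom h = eqToHom (by rw [h]) :=
  eqToHom_tensorHom_eqToHom rfl h

theorem eq_ofTerm {X Y : IF G H} (f : X ⟶ Y) :
    ∃ t : Term G H X.wires Y.wires, ofTerm t = f :=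
  ofTerm_surjective f

instance : MonoidalCategory (IF G H) :=
  MonoidalCategory.ofTensorHom
    (id_tensorHom_id := id_tensorHom_id)
    (id_tensorHom := fun _ _ _ _ => rfl)
    (tensorHom_id := fun _ _ => rfl)
    (tensorHom_comp_tensorHom := by
      intro X Y Z X' Y' Z' f f' g g'
      obtain ⟨f, rfl⟩ := eq_ofTerm f
      obtain ⟨g, rfl⟩ := eq_ofTerm g
      obtain ⟨f', rfl⟩ := eq_ofTerm f'
      obtain ⟨g', rfl⟩ := eq_ofTerm g'
      exact (sound (Eqv.interchange f g f' g')).symm)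
    (associator_naturality := by
      intro X X' X'' Y Y' Y'' f g h
      obtain ⟨f, rfl⟩ := eq_ofTerm f
      obtain ⟨g, rfl⟩ := eq_ofTerm g
      obtain ⟨h, rfl⟩ := eq_ofTerm h
      have := sound (Eqv.tensor_assoc f g h)
      rw [ofTerm_cast] at this
      rw [← ofTerm_tensor, ← ofTerm_tensor, ← ofTerm_tensor, ← ofTerm_tensor, ← this]
      simp [associator_eq])
    (leftUnitor_naturality := by
      intro X Y f
      obtain ⟨f, rfl⟩ := eq_ofTerm f
      have := sound (Eqv.unit_tensor f)
      rw [ofTerm_cast] at this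
      conv_rhs => rw [← this]
      simp [leftUnitor_eq]
      rfl)
    (rightUnitor_naturality := by
      intro X Y f
      obtain ⟨f, rfl⟩ := eq_ofTerm f
      have := sound (Eqv.tensor_unit f)
      rw [ofTerm_cast] at this
      conv_rhs => rw [← this]
      simp only [rightUnitor_eq, eqToIso.hom, eqToHom_trans_assoc]
      exact (Category.comp_id _).trans ((Category.id_comp _).trans (Category.comp_id _)).symm)
    (pentagon := by
      intro W X Y Z
      simp [associator_eq, eqToHom_tensorHom_id, id_tensorHom_eqToHom])
    (triangle := by
      intro X Y
      rw [associator_eq, leftUnitor_eq, rightUnitor_eq, eqToIso.hom, eqToIso.hom, eqToIso.hom,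
        id_tensorHom_eqToHom, eqToHom_tensorHom_id, eqToHom_trans])

/-- The symmetry of the PROP as an isomorphism. -/
def swapIso (X Y : IF G H) : X ⊗ Y ≅ Y ⊗ X where
  hom := ofTerm (Term.swap X.wires Y.wires)
  inv := ofTerm (Term.swap Y.wires X.wires)
  hom_inv_id := sound (Eqv.swap_swap X.wires Y.wires)
  inv_hom_id := sound (Eqv.swap_swap Y.wires X.wires)

theorem swapIso_naturality {X Y X' Y' : IF G H} (f : X ⟶ Y) (g : X' ⟶ Y') :
    (f ⊗ₘ g) ≫ (swapIso Y Y').hom = (swapIso X X').hom ≫ (g ⊗ₘ f) := by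
  obtain ⟨f, rfl⟩ := eq_ofTerm f
  obtain ⟨g, rfl⟩ := eq_ofTerm g
  exact sound (Eqv.swap_natural f g)

theorem swapIso_hexagon (X Y Z : IF G H) :
    (α_ X Y Z).hom ≫ (swapIso X (Y ⊗ Z)).hom ≫ (α_ Y Z X).hom =
      ((swapIso X Y).hom ▷ Z) ≫ (α_ Y X Z).hom ≫ (Y ◁ (swapIso X Z).hom) := by
  have := sound (Eqv.hexagon (G := G) (H := H) X.wires Y.wires Z.wires)
  rw [ofTerm_cast, ofTerm_comp, ofTerm_cast, ofTerm_tensor, ofTerm_tensor] at this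
  change _ ≫ ofTerm (Term.swap X.wires (Y.wires + Z.wires)) ≫ _ = _
  rw [this]
  simp [associator_eq]
  rfl

/-- The second hexagon is the inverse of the first one. -/
instance : SymmetricCategory (IF G H) where
  braiding := swapIso
  braiding_naturality_right X _ _ f := swapIso_naturality (𝟙 X) f
  braiding_naturality_left f Z := swapIso_naturality f (𝟙 Z)
  hexagon_forward := swapIso_hexagon
  hexagon_reverse X Y Z := by
    have h := congrArg Iso.inv (Iso.ext (α := (α_ Z X Y) ≪≫ swapIso Z (X ⊗ Y) ≪≫ (α_ X Y Z))
      (β := whiskerRightIso (swapIso Z X) Y ≪≫ (α_ X Z Y) ≪≫ whiskerLeftIso X (swapIso Z Y))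
      (swapIso_hexagon Z X Y))
    simpa [swapIso] using h
  symmetry X Y := sound (Eqv.swap_swap X.wires Y.wires)

end IF

/-! ### Bending wires in a symmetric monoidal category -/

section Bending

universe v u

variable {C : Type u} [Category.{v} C] [MonoidalCategory C]

/-- The wire that meets the left leg of a cup in a cap, read from left to right. -/
def bendRight {M : C} (cup : 𝟙_ C ⟶ M ⊗ M) (cap : M ⊗ M ⟶ 𝟙_ C) : M ⟶ M :=
  (ρ_ M).inv ≫ M ◁ cup ≫ (α_ M M M).inv ≫ cap ▷ M ≫ (λ_ M).hom

/-- The wire that meets the right leg of a cup in a cap, read from right to left. -/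
def bendLeft {M : C} (cup : 𝟙_ C ⟶ M ⊗ M) (cap : M ⊗ M ⟶ 𝟙_ C) : M ⟶ M :=
  (λ_ M).inv ≫ cup ▷ M ≫ (α_ M M M).hom ≫ M ◁ cap ≫ (ρ_ M).hom

/-- A bend slides off one leg of a cap, which takes the cap used in the bend in exchange. -/
theorem bendRight_whiskerRight_cap {M : C} {cup : 𝟙_ C ⟶ M ⊗ M} {cap : M ⊗ M ⟶ 𝟙_ C}
    (h : bendLeft cup cap = 𝟙 M) (cap' : M ⊗ M ⟶ 𝟙_ C) :
    bendRight cup cap' ▷ M ≫ cap = cap' := by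
  have h' : bendRight cup cap' ▷ M ≫ cap =
      M ◁ (bendLeft cup cap) ≫ cap' := by
    simp only [bendRight, bendLeft]
    calc _ = 𝟙 _ ⊗≫ M ◁ cup ▷ M ⊗≫ (cap' ▷ (M ⊗ M) ≫ (𝟙_ C) ◁ cap) ⊗≫ 𝟙 _ := by monoidal
      _ = 𝟙 _ ⊗≫ M ◁ cup ▷ M ⊗≫ ((M ⊗ M) ◁ cap ≫ cap' ▷ (𝟙_ C)) ⊗≫ 𝟙 _ := by
        rw [whisker_exchange]
      _ = _ := by monoidal
  rw [h', h]
  simp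

/-- Two bends that exchange the roles of two snake pairs are inverse to one another. -/
theorem bendRight_comp_bendRight {M : C} {cup cup' : 𝟙_ C ⟶ M ⊗ M} {cap cap' : M ⊗ M ⟶ 𝟙_ C}
    (h : bendLeft cup cap = 𝟙 M) (h' : bendRight cup' cap' = 𝟙 M) :
    bendRight cup cap' ≫ bendRight cup' cap = 𝟙 M := by
  have : bendRight cup cap' ≫ bendRight cup' cap =
      bendRight cup' (bendRight cup cap' ▷ M ≫ cap) := by
    generalize bendRight cup cap' = f
    simp only [bendRight]
    calc _ = 𝟙 _ ⊗≫ (f ▷ (𝟙_ C) ≫ M ◁ cup') ⊗≫ cap ▷ M ⊗≫ 𝟙 _ := by monoidal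
      _ = 𝟙 _ ⊗≫ (M ◁ cup' ≫ f ▷ (M ⊗ M)) ⊗≫ cap ▷ M ⊗≫ 𝟙 _ := by rw [whisker_exchange]
      _ = _ := by monoidal
  rw [this, bendRight_whiskerRight_cap h, h']

/-- A green comultiplication joined to a red multiplication through a bent wire is a red
comultiplication joined to a green multiplication. -/
theorem shear_eq_of_bend {M : C} {mg mr : M ⊗ M ⟶ M} {dg dr : M ⟶ M ⊗ M}
    {cup : 𝟙_ C ⟶ M ⊗ M} {cap : M ⊗ M ⟶ 𝟙_ C}
    (hdr : (λ_ M).inv ≫ cup ▷ M ≫ (α_ M M M).hom ≫ M ◁ mr = dr)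
    (hmg : dg ▷ M ≫ (α_ M M M).hom ≫ M ◁ cap ≫ (ρ_ M).hom = mg) :
    dg ▷ M ≫ (α_ M M M).hom ≫ M ◁ (bendRight cup cap ▷ M ≫ mr) =
      M ◁ dr ≫ (α_ M M M).inv ≫ mg ▷ M := by
  rw [← hdr, ← hmg, bendRight]
  symm
  calc _ = 𝟙 _ ⊗≫ M ◁ cup ▷ M ⊗≫ ((M ⊗ M) ◁ mr ≫ dg ▷ M ▷ M) ⊗≫ M ◁ cap ▷ M ⊗≫ 𝟙 _ := by
        monoidal
    _ = 𝟙 _ ⊗≫ (M ◁ cup ≫ dg ▷ (M ⊗ M)) ▷ M ⊗≫ (M ◁ ((M ⊗ M) ◁ mr ≫ cap ▷ M)) ⊗≫ 𝟙 _ := by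
        rw [whisker_exchange]
        monoidal
    _ = _ := by
        rw [whisker_exchange, whisker_exchange]
        monoidal

variable [SymmetricCategory C]

/-- With a symmetric cup, the crossing between the two legs of a bend can be straightened. -/
theorem bendLeft_eq_braid {M : C} {cup : 𝟙_ C ⟶ M ⊗ M} (cap : M ⊗ M ⟶ 𝟙_ C)
    (hcup : cup ≫ (β_ M M).hom = cup) :
    bendLeft cup cap = (λ_ M).inv ≫ cup ▷ M ≫ (α_ M M M).hom ≫ M ◁ (β_ M M).hom ≫
      (α_ M M M).inv ≫ cap ▷ M ≫ (λ_ M).hom := by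
  have hex := BraidedCategory.hexagon_forward M M M
  symm
  calc _ = (λ_ M).inv ≫ (cup ≫ (β_ M M).hom) ▷ M ≫ (α_ M M M).hom ≫ M ◁ (β_ M M).hom ≫
      (α_ M M M).inv ≫ cap ▷ M ≫ (λ_ M).hom := by rw [hcup]
    _ = (λ_ M).inv ≫ cup ▷ M ≫ ((β_ M M).hom ▷ M ≫ (α_ M M M).hom ≫ M ◁ (β_ M M).hom) ≫
      (α_ M M M).inv ≫ cap ▷ M ≫ (λ_ M).hom := by simp only [comp_whiskerRight, Category.assoc]
    _ = (λ_ M).inv ≫ cup ▷ M ≫ (α_ M M M).hom ≫ (β_ M (M ⊗ M)).hom ≫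
      cap ▷ M ≫ (λ_ M).hom := by
        rw [← hex]
        simp only [Category.assoc, Iso.hom_inv_id_assoc]
    _ = _ := by
        rw [← BraidedCategory.braiding_naturality_right_assoc]
        simp [bendLeft]

theorem bendLeft_eq_bendRight {M : C} {cup : 𝟙_ C ⟶ M ⊗ M} {cap : M ⊗ M ⟶ 𝟙_ C}
    (hcup : cup ≫ (β_ M M).hom = cup) (hcap : (β_ M M).hom ≫ cap = cap) :
    bendLeft cup cap = bendRight cup cap := by
  have hex := BraidedCategory.hexagon_reverse M M M
  calc _ = (λ_ M).inv ≫ cup ▷ M ≫ (α_ M M M).hom ≫ M ◁ (β_ M M).hom ≫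
      (α_ M M M).inv ≫ ((β_ M M).hom ≫ cap) ▷ M ≫ (λ_ M).hom := by
        rw [bendLeft_eq_braid _ hcup, hcap]
    _ = (λ_ M).inv ≫ cup ▷ M ≫ (α_ M M M).hom ≫ (M ◁ (β_ M M).hom ≫
      (α_ M M M).inv ≫ (β_ M M).hom ▷ M) ≫ cap ▷ M ≫ (λ_ M).hom := by
        simp only [comp_whiskerRight, Category.assoc]
    _ = (λ_ M).inv ≫ cup ▷ M ≫ (β_ (M ⊗ M) M).hom ≫ (α_ M M M).inv ≫
      cap ▷ M ≫ (λ_ M).hom := by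
        rw [← hex]
        simp only [Category.assoc, Iso.hom_inv_id_assoc]
    _ = _ := by
        rw [BraidedCategory.braiding_naturality_left_assoc]
        simp [bendRight]

/-- The Hopf law. Here `mg, hg, dg, eg` are the green and `mr, hr, er` the red operations. Closing
one output of the bialgebra law with the red counit gives two expressions for a morphism of inputs
`x` and `y`: the red cap of `x` and `y`, together with the red unit, and the red cap of one green
copy of each, together with the red product of the other copies. Then `x` is taken to be the green
unit. -/
theorem hopf_law {M : C} {mg mr : M ⊗ M ⟶ M} {dg : M ⟶ M ⊗ M} {hg hr : 𝟙_ C ⟶ M}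
    {eg er : M ⟶ 𝟙_ C}
    (frob : (ρ_ M).inv ≫ M ◁ (hg ≫ dg) ≫ (α_ M M M).inv ≫ mg ▷ M = dg)
    (cup_symm : (hg ≫ dg) ≫ (β_ M M).hom = hg ≫ dg)
    (bialg : mr ≫ dg = (dg ⊗ₘ dg) ≫ tensorμ M M M M ≫ (mr ⊗ₘ mr))
    (cocopy : mg ≫ er = (er ⊗ₘ er) ≫ (λ_ _).hom)
    (real_g : (λ_ M).inv ≫ hg ▷ M ≫ mr ≫ er = eg)
    (real_r : (hg ≫ dg) ≫ er ▷ M ≫ (λ_ M).hom = hr) :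
    dg ≫ bendLeft (hg ≫ dg) (mr ≫ er) ▷ M ≫ mr = eg ≫ hr := by
  -- Closing one leg of a green copy with `er` applies `er` and leaves the red unit: the dagger of
  -- the copying law, with one leg bent.
  have copy' : dg ≫ er ▷ M ≫ (λ_ M).hom = er ≫ hr := by
    clear cup_symm
    generalize hg ≫ dg = cup at frob real_r
    calc _ = (ρ_ M).inv ≫ M ◁ cup ≫ (α_ M M M).inv ≫ (mg ≫ er) ▷ M ≫ (λ_ M).hom := by
          conv_lhs => rw [← frob]
          simp only [comp_whiskerRight, Category.assoc]
      _ = 𝟙 _ ⊗≫ M ◁ cup ⊗≫ (er ▷ (M ⊗ M) ≫ (𝟙_ C) ◁ (er ▷ M)) ⊗≫ 𝟙 _ := by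
          rw [cocopy, MonoidalCategory.tensorHom_def]
          monoidal
      _ = 𝟙 _ ⊗≫ (M ◁ (cup ≫ er ▷ M ≫ (λ_ M).hom) ≫ er ▷ M) ⊗≫ 𝟙 _ := by
          rw [← whisker_exchange]
          monoidal
      _ = _ := by
          rw [real_r, whisker_exchange]
          monoidal
  -- The bialgebra law with the first output closed by `er`.
  have h1 : (mr ≫ er) ≫ hr = (dg ⊗ₘ dg) ≫ tensorμ M M M M ≫ ((mr ≫ er) ⊗ₘ mr) ≫ (λ_ M).hom := by
    rw [Category.assoc, ← copy', reassoc_of% bialg, ← tensorHom_id, tensorHom_comp_tensorHom_assoc,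
      Category.comp_id]
  calc _ = dg ≫ (λ_ _).inv ≫ ((hg ≫ dg) ▷ (M ⊗ M)) ≫ tensorμ M M M M ≫
        ((mr ≫ er) ⊗ₘ mr) ≫ (λ_ M).hom := by
        congr 1
        rw [bendLeft_eq_braid _ cup_symm, MonoidalCategory.tensorHom_def, tensorμ]
        monoidal
    _ = (λ_ M).inv ≫ hg ▷ M ≫ (dg ⊗ₘ dg) ≫ tensorμ M M M M ≫ ((mr ≫ er) ⊗ₘ mr) ≫ (λ_ M).hom := by
        rw [MonoidalCategory.tensorHom_def dg dg, Category.assoc, ← comp_whiskerRight_assoc,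
          ← whisker_exchange_assoc, ← leftUnitor_inv_naturality_assoc]
    _ = _ := by
        rw [← h1, ← real_g]
        simp

end Bending

/-! ### The group of points of a commutative Hopf monoid -/

section Points

universe v u

open scoped MonObj ComonObj

variable {C : Type u} [Category.{v} C] [MonoidalCategory C] [SymmetricCategory C]

/-- The comultiplication of a cocommutative comonoid is a morphism of comonoids. -/
instance isComonHom_comul (K : C) [ComonObj K] [IsCommComonObj K] : IsComonHom Δ[K] where
  hom_counit := by simp [MonoidalCategory.tensorHom_def]
  hom_comul := by
    have h : Δ[K] ≫ (Δ[K] ⊗ₘ Δ[K]) =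
        Δ[K] ≫ K ◁ (Δ[K] ≫ Δ[K] ▷ K ≫ (α_ K K K).hom) ≫ (α_ K K (K ⊗ K)).inv := by
      rw [← ComonObj.comul_assoc, MonoidalCategory.whiskerLeft_comp, Category.assoc,
        associator_inv_naturality_right, ComonObj.comul_assoc_assoc, Iso.hom_inv_id_assoc,
        MonoidalCategory.tensorHom_def]
    have h' : Δ[K] ≫ (Δ[K] ⊗ₘ Δ[K]) ≫ tensorμ K K K K = Δ[K] ≫ (Δ[K] ⊗ₘ Δ[K]) := by
      rw [reassoc_of% h, h, tensorμ, Iso.inv_hom_id_assoc]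
      simp only [← whiskerLeft_comp_assoc, Category.assoc, Iso.hom_inv_id_assoc]
      rw [← comp_whiskerRight_assoc, IsCommComonObj.comul_comm]
    rw [Comon.tensorObj_comul, h']

instance isComonHom_tensorHom {K L M N : C} [ComonObj K] [ComonObj L] [ComonObj M] [ComonObj N]
    (f : K ⟶ M) (g : L ⟶ N) [IsComonHom f] [IsComonHom g] : IsComonHom (f ⊗ₘ g) where
  hom_counit := by simp
  hom_comul := by
    simp only [Comon.tensorObj_comul, tensorHom_comp_tensorHom_assoc, IsComonHom.hom_comul,
      Category.assoc]
    rw [← tensorHom_comp_tensorHom_assoc, tensorμ_natural]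

instance isComonHom_mul (M : C) [BimonObj M] : IsComonHom μ[M] where
  hom_counit := by simp
  hom_comul := by simp

attribute [local instance] ComonObj.instTensorUnit in
instance isComonHom_one (M : C) [BimonObj M] : IsComonHom η[M] where
  hom_counit := by simp
  hom_comul := by simp [MonObj.tensorObj.one_def]

attribute [local instance] ComonObj.instTensorUnit in
instance isComonHom_counit (K : C) [ComonObj K] [IsCommComonObj K] : IsComonHom ε[K] where
  hom_counit := by simp
  hom_comul := by simp [unitors_inv_equal]

instance isComonHom_antipode (M : C) [HopfObj M] [IsCommComonObj M] :
    IsComonHom (HopfObj.antipode (X := M)) where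
  hom_counit := by simp
  hom_comul := by
    rw [HopfObj.antipode_comul, IsCommComonObj.comul_comm_assoc]

omit [SymmetricCategory C] in
theorem comul_tensorHom_comul_assoc {K X Y Z : C} [ComonObj K] (f : K ⟶ X) (g : K ⟶ Y)
    (h : K ⟶ Z) : (Δ[K] ≫ ((Δ[K] ≫ (f ⊗ₘ g)) ⊗ₘ h)) ≫ (α_ X Y Z).hom =
      Δ[K] ≫ (f ⊗ₘ (Δ[K] ≫ (g ⊗ₘ h))) := by
  have e1 : (Δ[K] ≫ (f ⊗ₘ g)) ⊗ₘ h = Δ[K] ▷ K ≫ ((f ⊗ₘ g) ⊗ₘ h) := by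
    rw [← tensorHom_id, tensorHom_comp_tensorHom, Category.id_comp]
  have e2 : f ⊗ₘ (Δ[K] ≫ (g ⊗ₘ h)) = K ◁ Δ[K] ≫ (f ⊗ₘ (g ⊗ₘ h)) := by
    rw [← id_tensorHom, tensorHom_comp_tensorHom, Category.id_comp]
  rw [e1, e2, ComonObj.comul_assoc_assoc, Category.assoc, Category.assoc, associator_naturality]

section Projections

attribute [local instance] ComonObj.instTensorUnit

/-- The projection from a tensor product of comonoids to its first factor. -/
def comonFst (K M : C) [ComonObj M] : K ⊗ M ⟶ K := (𝟙 K ⊗ₘ ε[M]) ≫ (ρ_ K).hom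

/-- The projection from a tensor product of comonoids to its second factor. -/
def comonSnd (K M : C) [ComonObj K] : K ⊗ M ⟶ M := (ε[K] ⊗ₘ 𝟙 M) ≫ (λ_ M).hom

instance (K M : C) [ComonObj K] [ComonObj M] [IsCommComonObj M] :
    IsComonHom (comonFst K M) :=
  have : IsComonHom (ρ_ K).hom :=
    { hom_counit := by simp [MonoidalCategory.tensorHom_def, unitors_equal]
      hom_comul := by
        rw [Comon.tensorObj_comul, tensorμ, braiding_tensorUnit_right]
        simp only [ComonObj.instTensorUnit_comul]
        monoidal }
  inferInstanceAs (IsComonHom ((𝟙 K ⊗ₘ ε[M]) ≫ (ρ_ K).hom))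

instance (K M : C) [ComonObj K] [ComonObj M] [IsCommComonObj K] :
    IsComonHom (comonSnd K M) :=
  have : IsComonHom (λ_ M).hom :=
    { hom_counit := by simp [MonoidalCategory.tensorHom_def]
      hom_comul := by
        rw [Comon.tensorObj_comul, tensorμ, braiding_tensorUnit_left]
        simp only [ComonObj.instTensorUnit_comul]
        monoidal }
  inferInstanceAs (IsComonHom ((ε[K] ⊗ₘ 𝟙 M) ≫ (λ_ M).hom))

theorem comul_comonFst_tensorHom_comonSnd (K M : C) [ComonObj K] [ComonObj M] :
    Δ[K ⊗ M] ≫ (comonFst K M ⊗ₘ comonSnd K M) = 𝟙 (K ⊗ M) := by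
  rw [comonFst, comonSnd, ← tensorHom_comp_tensorHom, Comon.tensorObj_comul, Category.assoc,
    ← tensorμ_natural_assoc, tensorHom_comp_tensorHom_assoc, id_tensorHom, tensorHom_id,
    ComonObj.comul_counit, ComonObj.counit_comul, tensorμ, braiding_tensorUnit_left]
  monoidal

end Projections

/-- The points of a comonoid `M` at a stage `K`: the morphisms of comonoids `K ⟶ M`. They form an
abelian group under convolution when `M` is a bicommutative Hopf monoid. -/
@[ext]
structure Points (K M : C) [ComonObj K] [ComonObj M] where
  /-- The underlying morphism. -/
  val : K ⟶ M
  /-- The underlying morphism respects the comonoid structures. -/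
  isComonHom : IsComonHom val

namespace Points

attribute [instance] Points.isComonHom

variable {K M : C} [ComonObj K] [IsCommComonObj K] [HopfObj M] [IsCommMonObj M]
  [IsCommComonObj M]

/-- The change of stage of a point along a morphism of comonoids. -/
def precomp {L K M : C} [ComonObj L] [ComonObj K] [ComonObj M] (f : L ⟶ K) [IsComonHom f]
    (p : Points K M) : Points L M := ⟨f ≫ p.val, inferInstance⟩

/-- The generic point: the identity of `M` at stage `M`. -/
protected def id (M : C) [ComonObj M] : Points M M := ⟨𝟙 M, inferInstance⟩

attribute [local instance] ComonObj.instTensorUnit in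
instance : Zero (Points K M) := ⟨⟨ε[K] ≫ η[M], inferInstance⟩⟩

instance : Add (Points K M) := ⟨fun p q => ⟨Δ[K] ≫ (p.val ⊗ₘ q.val) ≫ μ[M], inferInstance⟩⟩

instance : Neg (Points K M) := ⟨fun p => ⟨p.val ≫ HopfObj.antipode, inferInstance⟩⟩

omit [IsCommMonObj M] [IsCommComonObj M] in
theorem zero_val : (0 : Points K M).val = ε[K] ≫ η[M] := rfl

omit [IsCommMonObj M] [IsCommComonObj M] in
theorem add_val (p q : Points K M) : (p + q).val = Δ[K] ≫ (p.val ⊗ₘ q.val) ≫ μ[M] := rfl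

omit [IsCommComonObj K] [IsCommMonObj M] in
theorem neg_val (p : Points K M) : (-p).val = p.val ≫ HopfObj.antipode := rfl

omit [IsCommMonObj M] [IsCommComonObj M] in
theorem add_val_eq_conv (p q : Points K M) :
    (p + q).val = ((show Conv K M from p.val) * (show Conv K M from q.val) : Conv K M) := by
  rw [add_val, Conv.mul_eq, MonoidalCategory.tensorHom_def, Category.assoc]

instance : AddCommGroup (Points K M) where
  add_assoc p q r := Points.ext (by
    simp only [add_val_eq_conv]
    exact mul_assoc (G := Conv K M) _ _ _)
  zero_add p := Points.ext (by
    rw [add_val_eq_conv]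
    exact one_mul (M := Conv K M) _)
  add_zero p := Points.ext (by
    rw [add_val_eq_conv]
    exact mul_one (M := Conv K M) _)
  add_comm p q := Points.ext (by
    rw [add_val, add_val, ← IsCommComonObj.comul_comm_assoc K,
      ← BraidedCategory.braiding_naturality_assoc, IsCommMonObj.mul_comm])
  neg_add_cancel p := Points.ext (by
    rw [add_val, neg_val, zero_val]
    have h := IsComonHom.hom_comul p.val
    calc _ = (Δ[K] ≫ (p.val ⊗ₘ p.val)) ≫ HopfObj.antipode ▷ M ≫ μ[M] := by
          rw [← tensorHom_id, Category.assoc, tensorHom_comp_tensorHom_assoc, Category.comp_id]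
      _ = _ := by
          rw [← h, Category.assoc, HopfObj.antipode_left, IsComonHom.hom_counit_assoc])
  nsmul := nsmulRec
  zsmul := zsmulRec

end Points

end Points

namespace IF

variable {G H : Type*} [CommGroup G] [CommGroup H]

/-! ### The two Frobenius algebras and the Hopf algebra on one wire -/

section Wire

open Colour

variable (G H) in
/-- The generating object. -/
abbrev wire : IF G H := ⟨1⟩

/-- The multiplication of the given colour. -/
def mul (c : Colour) : wire G H ⊗ wire G H ⟶ wire G H := ofTerm (Term.mu c)

/-- The unit of the given colour. -/
def unit (c : Colour) : 𝟙_ (IF G H) ⟶ wire G H := ofTerm (Term.eta c)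

/-- The comultiplication of the given colour. -/
def comul (c : Colour) : wire G H ⟶ wire G H ⊗ wire G H := ofTerm (Term.delta c)

/-- The counit of the given colour. -/
def counit (c : Colour) : wire G H ⟶ 𝟙_ (IF G H) := ofTerm (Term.eps c)

theorem unit_mul (c : Colour) : unit c ▷ wire G H ≫ mul c = (λ_ (wire G H)).hom :=
  sound (Eqv.mu_unit c)

theorem braiding_mul (c : Colour) : (β_ (wire G H) (wire G H)).hom ≫ mul c = mul c :=
  sound (Eqv.mu_comm c)

theorem mul_assoc (c : Colour) : mul c ▷ wire G H ≫ mul c =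
    (α_ (wire G H) (wire G H) (wire G H)).hom ≫ wire G H ◁ mul c ≫ mul c :=
  (sound (Eqv.mu_assoc c)).trans (Category.id_comp _).symm

theorem mul_unit (c : Colour) : wire G H ◁ unit c ≫ mul c = (ρ_ (wire G H)).hom := by
  rw [← braiding_mul, BraidedCategory.braiding_naturality_right_assoc, unit_mul]
  simp

theorem comul_counit (c : Colour) : comul c ≫ counit c ▷ wire G H = (λ_ (wire G H)).inv :=
  sound (Eqv.dagger_congr (Eqv.mu_unit c))

theorem comul_braiding (c : Colour) : comul c ≫ (β_ (wire G H) (wire G H)).hom = comul c :=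
  sound (Eqv.dagger_congr (Eqv.mu_comm c))

theorem comul_assoc (c : Colour) : comul c ≫ comul c ▷ wire G H =
    (comul c ≫ wire G H ◁ comul c) ≫ (α_ (wire G H) (wire G H) (wire G H)).inv :=
  (sound (Eqv.dagger_congr (Eqv.mu_assoc c))).trans (Category.comp_id _).symm

theorem comul_counit' (c : Colour) : comul c ≫ wire G H ◁ counit c = (ρ_ (wire G H)).inv := by
  rw [← comul_braiding, Category.assoc, ← BraidedCategory.braiding_naturality_left,
    reassoc_of% comul_counit c]
  simp

theorem frobenius_left (c : Colour) :
    comul c ▷ wire G H ≫ (α_ (wire G H) (wire G H) (wire G H)).hom ≫ wire G H ◁ mul c =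
      mul c ≫ comul c := by
  refine Eq.trans ?_ (sound (Eqv.frobenius_left c))
  exact congrArg (CategoryStruct.comp (comul c ▷ wire G H)) (Category.id_comp _)

theorem frobenius_right (c : Colour) :
    wire G H ◁ comul c ≫ (α_ (wire G H) (wire G H) (wire G H)).inv ≫ mul c ▷ wire G H =
      mul c ≫ comul c := by
  refine Eq.trans ?_ (sound (Eqv.frobenius_right c))
  exact congrArg (CategoryStruct.comp (wire G H ◁ comul c)) (Category.id_comp _)

theorem comul_eq_left (c : Colour) :
    (λ_ (wire G H)).inv ≫ (unit c ≫ comul c) ▷ wire G H ≫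
      (α_ (wire G H) (wire G H) (wire G H)).hom ≫ wire G H ◁ mul c = comul c := by
  rw [comp_whiskerRight_assoc, frobenius_left, reassoc_of% unit_mul c, Iso.inv_hom_id_assoc]

theorem comul_eq_right (c : Colour) :
    (ρ_ (wire G H)).inv ≫ wire G H ◁ (unit c ≫ comul c) ≫
      (α_ (wire G H) (wire G H) (wire G H)).inv ≫ mul c ▷ wire G H = comul c := by
  rw [whiskerLeft_comp_assoc, frobenius_right, reassoc_of% mul_unit c, Iso.inv_hom_id_assoc]

theorem mul_eq_left (c : Colour) :
    comul c ▷ wire G H ≫ (α_ (wire G H) (wire G H) (wire G H)).hom ≫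
      wire G H ◁ (mul c ≫ counit c) ≫ (ρ_ (wire G H)).hom = mul c := by
  rw [whiskerLeft_comp_assoc, reassoc_of% frobenius_left c, reassoc_of% comul_counit' c,
    Iso.inv_hom_id, Category.comp_id]

/-- The cup of the given colour. -/
def cup (c : Colour) : 𝟙_ (IF G H) ⟶ wire G H ⊗ wire G H := unit c ≫ comul c

/-- The cap of the given colour. -/
def cap (c : Colour) : wire G H ⊗ wire G H ⟶ 𝟙_ (IF G H) := mul c ≫ counit c

theorem cup_braiding (c : Colour) : cup c ≫ (β_ (wire G H) (wire G H)).hom = cup c := by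
  rw [cup, Category.assoc, comul_braiding]

theorem braiding_cap (c : Colour) : (β_ (wire G H) (wire G H)).hom ≫ cap c = cap c := by
  rw [cap, ← Category.assoc, braiding_mul]

theorem bendLeft_cup_cap (c : Colour) : bendLeft (cup c) (cap c) = 𝟙 (wire G H) := by
  have := comul_eq_left (G := G) (H := H) c
  rw [bendLeft, cap, whiskerLeft_comp_assoc, cup, reassoc_of% this, reassoc_of% comul_counit' c,
    Iso.inv_hom_id]

theorem bendRight_cup_cap (c : Colour) : bendRight (cup c) (cap c) = 𝟙 (wire G H) := by
  rw [← bendLeft_eq_bendRight (cup_braiding c) (braiding_cap c), bendLeft_cup_cap]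

theorem green_unit_red_cap :
    (λ_ (wire G H)).inv ≫ unit green ▷ wire G H ≫ mul red ≫ counit red = counit green :=
  (Category.id_comp _).trans (sound Eqv.green_unit_real)

theorem green_cup_red_counit :
    (unit green ≫ comul green) ≫ counit red ▷ wire G H ≫ (λ_ (wire G H)).hom = unit red := by
  refine Eq.trans ?_ (sound Eqv.red_unit_real)
  exact congrArg (CategoryStruct.comp (cup green)) (Category.comp_id _)

theorem comp_of_eq_id {X Y : IF G H} {f : X ⟶ X} (h : f = 𝟙 X) (g : X ⟶ Y) : f ≫ g = g := by
  rw [h, Category.id_comp]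

theorem tensorμ_wire : tensorμ (wire G H) (wire G H) (wire G H) (wire G H) =
    ofTerm Term.middleSwap := by
  -- The associators are identities up to unfolding the arities, which leaves the crossing alone.
  refine (Category.id_comp _).trans ?_
  refine (comp_of_eq_id (X := ⟨4⟩)
    (MonoidalCategory.whiskerLeft_id (wire G H) (⟨3⟩ : IF G H)) _).trans ?_
  refine Eq.trans ?_ (Category.comp_id _)
  refine congrArg (CategoryStruct.comp (wire G H ◁ (β_ (wire G H) (wire G H)).hom ▷ wire G H)) ?_
  exact comp_of_eq_id (X := ⟨4⟩)
    (MonoidalCategory.whiskerLeft_id (wire G H) (⟨3⟩ : IF G H)) _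

theorem mul_red_comul_green : mul red ≫ comul green = (comul green ⊗ₘ comul green) ≫
    tensorμ (wire G H) (wire G H) (wire G H) (wire G H) ≫ (mul red ⊗ₘ mul red) := by
  rw [tensorμ_wire]
  exact sound Eqv.bialgebra

theorem unit_red_comul_green :
    unit red ≫ comul green = (λ_ (𝟙_ (IF G H))).inv ≫ (unit red ⊗ₘ unit red) :=
  (sound Eqv.copy).trans (Category.id_comp _).symm

theorem mul_red_counit_green :
    mul red ≫ counit green = (counit green ⊗ₘ counit green) ≫ (λ_ (𝟙_ (IF G H))).hom :=
  (sound Eqv.cocopy).trans (Category.comp_id _).symm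

theorem unit_red_counit_green : unit red ≫ counit green = 𝟙 (𝟙_ (IF G H)) :=
  sound Eqv.bone

theorem mul_green_counit_red :
    mul green ≫ counit red = (counit red ⊗ₘ counit red) ≫ (λ_ (𝟙_ (IF G H))).hom :=
  (sound (Eqv.dagger_congr Eqv.copy)).trans (Category.comp_id _).symm

/-- The green comonoid and the red monoid form a Hopf monoid. Its antipode is the dagger of
`Term.antipode`, a green cup joined to a red cap. -/
instance : HopfObj (wire G H) where
  one := unit red
  mul := mul red
  counit := counit green
  comul := comul green
  antipode := bendLeft (cup green) (cap red)
  one_mul := unit_mul red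
  mul_one := mul_unit red
  mul_assoc := mul_assoc red
  counit_comul := comul_counit green
  comul_counit := comul_counit' green
  comul_assoc := by
    rw [reassoc_of% comul_assoc green, Iso.inv_hom_id, Category.comp_id]
  mul_comul := mul_red_comul_green
  one_comul := unit_red_comul_green
  mul_counit := mul_red_counit_green
  one_counit := unit_red_counit_green
  antipode_left := hopf_law (comul_eq_right green) (cup_braiding green) mul_red_comul_green
    mul_green_counit_red green_unit_red_cap green_cup_red_counit
  antipode_right := by
    rw [← hopf_law (comul_eq_right green) (cup_braiding green) mul_red_comul_green
      mul_green_counit_red green_unit_red_cap green_cup_red_counit]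
    conv_lhs => rw [← braiding_mul, ← comul_braiding]
    rw [Category.assoc, ← BraidedCategory.braiding_naturality_left_assoc,
      SymmetricCategory.symmetry_assoc]
    rfl

instance : IsCommMonObj (wire G H) where
  mul_comm := braiding_mul red

instance : IsCommComonObj (wire G H) where
  comul_comm := comul_braiding green

open scoped MonObj ComonObj HopfObj

/-- The antipode is the inverse of the generic point, and inversion in a group is an involution. -/
theorem antipode_comp_antipode : 𝒮[wire G H] ≫ 𝒮[wire G H] = 𝟙 (wire G H) := by
  have h := congrArg Points.val (neg_neg (Points.id (wire G H)))
  rwa [Points.neg_val, Points.neg_val, Points.id, Category.id_comp] at h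

theorem ofTerm_dagger_antipode : ofTerm Term.antipode.dagger = 𝒮[wire G H] := by
  symm
  change bendLeft (cup green) (cap red) = _
  refine (Category.id_comp _).trans ?_
  exact congrArg (CategoryStruct.comp (cup green ▷ wire G H))
    ((Category.id_comp _).trans (Category.comp_id _))

theorem ofTerm_antipode_eq_bendRight :
    ofTerm Term.antipode = bendRight (cup red) (cap green) (M := wire G H) := by
  symm
  refine (Category.id_comp _).trans ?_
  exact congrArg (CategoryStruct.comp (wire G H ◁ cup red))
    ((Category.id_comp _).trans (Category.comp_id _))

/-- The antipode of `HA` is self-adjoint: it is inverse to its dagger, which is an involution. -/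
theorem ofTerm_antipode : ofTerm Term.antipode = 𝒮[wire G H] := by
  have h : 𝒮[wire G H] ≫ ofTerm Term.antipode = 𝟙 (wire G H) := by
    have h' : 𝒮[wire G H] = bendRight (cup green) (cap red) :=
      bendLeft_eq_bendRight (cup_braiding green) (braiding_cap red)
    rw [h', ofTerm_antipode_eq_bendRight]
    exact bendRight_comp_bendRight (bendLeft_cup_cap green) (bendRight_cup_cap red)
  rw [← Category.id_comp (ofTerm _), ← antipode_comp_antipode, Category.assoc, h, Category.comp_id]

end Wire

end IF

/-! ### Integer matrices acting on tuples in an abelian group -/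

section Act

variable {A : Type*} [AddCommGroup A]

/-- The action of an integer matrix on tuples of elements of an abelian group. -/
def act {m n : ℕ} (M : Matrix (Fin m) (Fin n) ℤ) (p : Fin n → A) : Fin m → A :=
  fun i => ∑ j, M i j • p j

@[simp]
theorem act_one {n : ℕ} (p : Fin n → A) : act 1 p = p := by
  ext i
  simp [act, Matrix.one_apply]

theorem act_mul {l m n : ℕ} (M : Matrix (Fin l) (Fin m) ℤ) (N : Matrix (Fin m) (Fin n) ℤ)
    (p : Fin n → A) : act (M * N) p = act M (act N p) := by
  ext i
  simp only [act, Matrix.mul_apply, Finset.sum_smul, Finset.smul_sum, mul_smul]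
  exact Finset.sum_comm

/-- The matrix that reindexes a tuple along `e`. -/
def reindexMatrix {m n : ℕ} (e : Fin m → Fin n) : Matrix (Fin m) (Fin n) ℤ :=
  Matrix.of fun i j => if e i = j then 1 else 0

@[simp]
theorem act_reindexMatrix {m n : ℕ} (e : Fin m → Fin n) (p : Fin n → A) :
    act (reindexMatrix e) p = p ∘ e := by
  ext i
  simp [act, reindexMatrix]

/-- The block diagonal sum of two matrices. -/
def blockSum {m n m' n' : ℕ} (M : Matrix (Fin m) (Fin n) ℤ) (N : Matrix (Fin m') (Fin n') ℤ) :
    Matrix (Fin (m + m')) (Fin (n + n')) ℤ :=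
  Matrix.reindex finSumFinEquiv finSumFinEquiv (Matrix.fromBlocks M 0 0 N)

@[simp]
theorem act_blockSum {m n m' n' : ℕ} (M : Matrix (Fin m) (Fin n) ℤ)
    (N : Matrix (Fin m') (Fin n') ℤ) (p : Fin n → A) (q : Fin n' → A) :
    act (blockSum M N) (Fin.append p q) = Fin.append (act M p) (act N q) := by
  ext i
  refine Fin.addCases (fun i => ?_) (fun i => ?_) i <;>
    simp [act, blockSum, Fin.sum_univ_add]

theorem act_neg_one {n : ℕ} (p : Fin n → A) : act (-1) p = -p := by
  ext i
  simp [act, Matrix.one_apply]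

end Act

namespace IF

variable {G H : Type*} [CommGroup G] [CommGroup H]

open scoped MonObj ComonObj HopfObj

/-! ### Tuples of points -/

section Tuple

variable {K : IF G H} [ComonObj K] [IsCommComonObj K]

/-- The morphism into `n` wires whose components are the given points. -/
def tuple : {n : ℕ} → (Fin n → Points K (wire G H)) → (K ⟶ (⟨n⟩ : IF G H))
  | 0, _ => ε[K]
  | n + 1, p => Δ[K] ≫ (tuple (fun i => p i.castSucc) ⊗ₘ (p (Fin.last n)).val)

omit [IsCommComonObj K] in
theorem tuple_succ {n : ℕ} (p : Fin (n + 1) → Points K (wire G H)) :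
    tuple p = Δ[K] ≫ (tuple (fun i => p i.castSucc) ⊗ₘ (p (Fin.last n)).val) := rfl

omit [IsCommComonObj K] in
theorem tuple_one (p : Fin 1 → Points K (wire G H)) : tuple p = (p 0).val := by
  refine (ComonObj.counit_comul_hom (p 0).val).trans ?_
  exact Category.comp_id _

omit [IsCommComonObj K] in
theorem tuple_two (p : Fin 2 → Points K (wire G H)) :
    tuple p = Δ[K] ≫ ((p 0).val ⊗ₘ (p 1).val) := by
  rw [tuple_succ, tuple_one]
  rfl

omit [IsCommComonObj K] in
theorem tuple_append {m n : ℕ} (p : Fin m → Points K (wire G H))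
    (q : Fin n → Points K (wire G H)) :
    (tuple (Fin.append p q) : K ⟶ (⟨m⟩ ⊗ ⟨n⟩ : IF G H)) = Δ[K] ≫ (tuple p ⊗ₘ tuple q) := by
  induction n with
  | zero =>
    have h : (Fin.append p q : Fin m → _) = p := funext (Fin.append_left p q)
    refine (congrArg tuple h).trans ?_
    refine Eq.trans ?_ (ComonObj.comul_counit_hom (tuple p)).symm
    exact (Category.comp_id _).symm
  | succ n ih =>
    have h : (fun i : Fin (m + n) => Fin.append (n := n + 1) p q (Fin.castSucc i)) =
        Fin.append p (fun i => q i.castSucc) := by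
      funext i
      refine Fin.addCases (fun i => ?_) (fun i => ?_) i
      · rw [Fin.append_left]
        exact Fin.append_left (n := n + 1) p q i
      · rw [Fin.append_right]
        exact Fin.append_right (n := n + 1) p q i.castSucc
    have h' : Fin.append (n := n + 1) p q (Fin.last (m + n)) = q (Fin.last n) :=
      Fin.append_right (n := n + 1) p q (Fin.last n)
    have h1 : tuple (n := m + n + 1) (Fin.append (n := n + 1) p q) =
        Δ[K] ≫ ((Δ[K] ≫ (tuple p ⊗ₘ tuple (fun i => q i.castSucc))) ⊗ₘ (q (Fin.last n)).val) := by
      rw [← ih, ← h, ← h']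
      rfl
    refine h1.trans ?_
    -- The associator of `m`, `n` and `1` wires is an identity by unfolding.
    refine Eq.trans ?_ (comul_tensorHom_comul_assoc (tuple p)
      (tuple (fun i => q i.castSucc)) (q (Fin.last n)).val)
    exact (Category.comp_id _).symm

omit [IsCommComonObj K] in
theorem isComonHom_comp_tuple {L : IF G H} [ComonObj L] (f : L ⟶ K) [IsComonHom f] {n : ℕ}
    (p : Fin n → Points K (wire G H)) :
    f ≫ tuple p = tuple (fun i => (p i).precomp f) := by
  induction n with
  | zero => exact IsComonHom.hom_counit f
  | succ n ih =>
    rw [tuple_succ, tuple_succ, ← ih, IsComonHom.hom_comul_assoc, tensorHom_comp_tensorHom]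
    rfl

end Tuple

variable (G H) in
/-- Some stage has a tuple of points that is the generic one, up to isomorphism. -/
theorem exists_tuple_isIso (n : ℕ) : ∃ (K : CommComon (IF G H))
    (p : Fin n → Points K.X (wire G H)), IsIso (tuple p) := by
  induction n with
  | zero =>
    let _ := ComonObj.instTensorUnit (IF G H)
    refine ⟨CommComon.trivial (IF G H), Fin.elim0, ?_⟩
    change IsIso (𝟙 (𝟙_ (IF G H)))
    infer_instance
  | succ n ih =>
    obtain ⟨K, p, hp⟩ := ih
    let q : Fin (n + 1) → Points (K.X ⊗ wire G H) (wire G H) :=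
      Fin.snoc (α := fun _ => Points (K.X ⊗ wire G H) (wire G H))
        (fun i => (p i).precomp (comonFst K.X (wire G H)))
        ⟨comonSnd K.X (wire G H), inferInstance⟩
    have hq : tuple q = tuple p ▷ wire G H := by
      have h : (fun i : Fin n => q i.castSucc) =
          fun i => (p i).precomp (comonFst K.X (wire G H)) := by
        ext i
        simp [q]
      have h' : (q (Fin.last n)).val = comonSnd K.X (wire G H) := by simp [q]
      rw [tuple_succ, h, h', ← isComonHom_comp_tuple]
      calc _ = (Δ[K.X ⊗ wire G H] ≫ (comonFst K.X (wire G H) ⊗ₘ comonSnd K.X (wire G H))) ≫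
            (tuple p ⊗ₘ 𝟙 (wire G H)) := by
            rw [Category.assoc, tensorHom_comp_tensorHom, Category.comp_id]
        _ = _ := by rw [comul_comonFst_tensorHom_comonSnd, Category.id_comp, tensorHom_id]
    refine ⟨⟨K.X ⊗ wire G H⟩, q, ?_⟩
    rw [hq]
    exact inferInstanceAs (IsIso (tuple p ▷ wire G H))

end IF

/-! ### The relational model over the integers -/

variable {G H : Type*}

/-- The relation on integer labellings of the wires denoted by a generator: green operations copy or
discard labels, red operations add them, and phases act trivially. Labellings are functions on all
of `ℕ`, of which only the values below the arity matter; no transports of arities occur then. -/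
def Gen.rel : {m n : ℕ} → Gen G H m n → (ℕ → ℤ) → (ℕ → ℤ) → Prop
  | _, _, .mu .green, x, y => x 0 = y 0 ∧ x 1 = y 0
  | _, _, .mu .red, x, y => x 0 + x 1 = y 0
  | _, _, .eta .green, _, _ => True
  | _, _, .eta .red, _, y => y 0 = 0
  | _, _, .delta .green, x, y => y 0 = x 0 ∧ y 1 = x 0
  | _, _, .delta .red, x, y => y 0 + y 1 = x 0
  | _, _, .eps .green, _, _ => True
  | _, _, .eps .red, x, _ => x 0 = 0
  | _, _, .greenPhase _, x, y => x 0 = y 0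
  | _, _, .redPhase _, x, y => x 0 = y 0

/-- The relation on integer labellings of the wires denoted by a term. -/
def Term.rel : {m n : ℕ} → Term G H m n → (ℕ → ℤ) → (ℕ → ℤ) → Prop
  | _, _, .gen g, x, y => g.rel x y
  | _, _, .idn n, x, y => ∀ i < n, x i = y i
  | _, _, .swap m n, x, y => (∀ i < m, x i = y (n + i)) ∧ (∀ i < n, x (m + i) = y i)
  | _, _, .comp f g, x, y => ∃ z, f.rel x z ∧ g.rel z y
  | _, _, .tensor (m := m) (n := n) f g, x, y =>
      f.rel x y ∧ g.rel (fun i => x (m + i)) (fun i => y (n + i))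

namespace Term

theorem rel_cast {m n m' n' : ℕ} (hm : m = m') (hn : n = n') (f : Term G H m n) :
    (f.cast hm hn).rel = f.rel := by
  subst hm hn
  rfl

theorem rel_of_eqOn {m n : ℕ} (f : Term G H m n) : ∀ {x x' y y' : ℕ → ℤ}, (∀ i < m, x i = x' i) →
    (∀ i < n, y i = y' i) → f.rel x y → f.rel x' y' := by
  induction f with
  | gen g =>
    intro x x' y y' hx hy h
    cases g with
    | mu c => cases c <;> simpa [rel, Gen.rel, ← hx, ← hy] using h
    | eta c => cases c <;> simp_all [rel, Gen.rel]
    | delta c => cases c <;> simpa [rel, Gen.rel, ← hx, ← hy] using h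
    | eps c => cases c <;> simp_all [rel, Gen.rel]
    | greenPhase _ => simpa [rel, Gen.rel, ← hx, ← hy] using h
    | redPhase _ => simpa [rel, Gen.rel, ← hx, ← hy] using h
  | idn n =>
    intro x x' y y' hx hy h i hi
    rw [← hx i hi, ← hy i hi, h i hi]
  | swap m n =>
    rintro x x' y y' hx hy ⟨h, h'⟩
    exact ⟨fun i hi => by rw [← hx _ (by omega), ← hy _ (by omega), h i hi],
      fun i hi => by rw [← hx _ (by omega), ← hy _ (by omega), h' i hi]⟩
  | comp f g ihf ihg =>
    rintro x x' y y' hx hy ⟨z, h, h'⟩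
    exact ⟨z, ihf hx (fun _ _ => rfl) h, ihg (fun _ _ => rfl) hy h'⟩
  | tensor f g ihf ihg =>
    rintro x x' y y' hx hy ⟨h, h'⟩
    exact ⟨ihf (fun i hi => hx i (by omega)) (fun i hi => hy i (by omega)) h,
      ihg (fun i hi => hx _ (by omega)) (fun i hi => hy _ (by omega)) h'⟩

theorem rel_dagger [CommGroup G] [CommGroup H] {m n : ℕ} (f : Term G H m n) :
    ∀ x y : ℕ → ℤ, f.dagger.rel y x ↔ f.rel x y := by
  induction f with
  | gen g =>
    intro x y
    cases g with
    | mu c => cases c <;> simp [rel, Gen.rel, dagger, Gen.dagger]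
    | eta c => cases c <;> simp [rel, Gen.rel, dagger, Gen.dagger]
    | delta c => cases c <;> simp [rel, Gen.rel, dagger, Gen.dagger, eq_comm]
    | eps c => cases c <;> simp [rel, Gen.rel, dagger, Gen.dagger]
    | greenPhase _ => exact eq_comm
    | redPhase _ => exact eq_comm
  | idn n =>
    intro x y
    simp only [rel, dagger, eq_comm]
  | swap m n =>
    intro x y
    simp only [rel, dagger, eq_comm]
    exact and_comm
  | comp f g ihf ihg =>
    intro x y
    simp only [rel, dagger, ihf, ihg]
    exact exists_congr fun z => and_comm
  | tensor f g ihf ihg =>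
    intro x y
    simp only [rel, dagger, ihf, ihg]

/-- Concatenation of labellings, the first one being of length `n`. -/
def concat (n : ℕ) (x y : ℕ → ℤ) (i : ℕ) : ℤ := if i < n then x i else y (i - n)

theorem concat_of_lt {n i : ℕ} (h : i < n) (x y : ℕ → ℤ) : concat n x y i = x i := if_pos h

@[simp]
theorem concat_add (n i : ℕ) (x y : ℕ → ℤ) : concat n x y (n + i) = y i := by
  simp [concat]

/-- The labelling of the first four wires by the given integers. -/
def label (a b c d : ℤ) : ℕ → ℤ
  | 0 => a
  | 1 => b
  | 2 => c
  | _ => d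

end Term

open Term Colour in
/-- Soundness of the relational model. -/
theorem Eqv.rel [CommGroup G] [CommGroup H] {m n : ℕ} {f g : Term G H m n} (h : Eqv G H f g) :
    ∀ x y : ℕ → ℤ, f.rel x y ↔ g.rel x y := by
  induction h with
  | refl f => exact fun _ _ => Iff.rfl
  | symm _ ih => exact fun x y => (ih x y).symm
  | trans _ _ ih ih' => exact fun x y => (ih x y).trans (ih' x y)
  | comp_congr _ _ ih ih' => exact fun x y => exists_congr fun z => and_congr (ih x z) (ih' z y)
  | tensor_congr _ _ ih ih' => exact fun x y => and_congr (ih _ _) (ih' _ _)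
  | dagger_congr _ ih => exact fun x y => by rw [rel_dagger, rel_dagger, ih]
  | id_comp f =>
    refine fun x y => ⟨?_, fun h => ⟨x, fun _ _ => rfl, h⟩⟩
    rintro ⟨z, hz, h⟩
    exact f.rel_of_eqOn (fun i hi => (hz i hi).symm) (fun _ _ => rfl) h
  | comp_id f =>
    refine fun x y => ⟨?_, fun h => ⟨y, h, fun _ _ => rfl⟩⟩
    rintro ⟨z, h, hz⟩
    exact f.rel_of_eqOn (fun _ _ => rfl) hz h
  | comp_assoc f g h =>
    intro x y
    constructor
    · rintro ⟨z, ⟨w, hf, hg⟩, hh⟩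
      exact ⟨w, hf, z, hg, hh⟩
    · rintro ⟨w, hf, z, hg, hh⟩
      exact ⟨z, ⟨w, hf, hg⟩, hh⟩
  | id_tensor_id m n =>
    intro x y
    refine ⟨fun ⟨h, h'⟩ i hi => ?_,
      fun h => ⟨fun i hi => h i (by omega), fun i hi => h _ (by omega)⟩⟩
    rcases lt_or_ge i m with him | him
    · exact h i him
    · have := h' (i - m) (by omega)
      simpa only [Nat.add_sub_cancel' him] using this
  | @interchange l m n l' m' n' f g f' g' =>
    intro x y
    constructor
    · rintro ⟨⟨z, hf, hg⟩, z', hf', hg'⟩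
      refine ⟨concat m z z', ⟨f.rel_of_eqOn (fun _ _ => rfl) ?_ hf,
        f'.rel_of_eqOn (fun _ _ => rfl) ?_ hf'⟩, g.rel_of_eqOn ?_ (fun _ _ => rfl) hg,
        g'.rel_of_eqOn ?_ (fun _ _ => rfl) hg'⟩
      · exact fun i hi => by simp [concat, hi]
      · exact fun i hi => (concat_add _ _ _ _).symm
      · exact fun i hi => by simp [concat, hi]
      · exact fun i hi => (concat_add _ _ _ _).symm
    · rintro ⟨z, ⟨hf, hf'⟩, hg, hg'⟩
      exact ⟨⟨z, hf, hg⟩, _, hf', hg'⟩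
  | tensor_assoc f g h =>
    intro x y
    rw [rel_cast]
    simp only [Term.rel, and_assoc, Nat.add_assoc]
  | unit_tensor f =>
    intro x y
    rw [rel_cast]
    simp [Term.rel]
  | tensor_unit f =>
    intro x y
    rw [rel_cast]
    simp [Term.rel]
  | @swap_natural m n m' n' f g =>
    intro x y
    constructor
    · rintro ⟨z, ⟨hf, hg⟩, h, h'⟩
      refine ⟨concat m' (fun i => x (m + i)) x, ⟨?_, ?_⟩, ?_, ?_⟩
      · exact fun i hi => (concat_add _ _ _ _).symm
      · exact fun i hi => by simp [concat, hi]
      · exact g.rel_of_eqOn (fun i hi => (concat_of_lt hi _ _).symm) h' hg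
      · exact f.rel_of_eqOn (fun i hi => (concat_add _ _ _ _).symm) h hf
    · rintro ⟨z, ⟨h, h'⟩, hg, hf⟩
      refine ⟨concat n (fun i => y (n' + i)) y, ⟨?_, ?_⟩, ?_, ?_⟩
      · exact f.rel_of_eqOn (fun i hi => (h i hi).symm)
          (fun i hi => (concat_of_lt hi _ _).symm) hf
      · exact g.rel_of_eqOn (fun i hi => (h' i hi).symm)
          (fun i hi => (concat_add _ _ _ _).symm) hg
      · exact fun i hi => concat_of_lt hi _ _
      · exact fun i hi => concat_add _ _ _ _
  | swap_swap m n =>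
    intro x y
    constructor
    · rintro ⟨z, ⟨h1, h2⟩, h3, h4⟩ i hi
      rcases lt_or_ge i m with him | him
      · rw [h1 i him, h4 i him]
      · have e := (h2 (i - m) (by omega)).trans (h3 (i - m) (by omega))
        rwa [Nat.add_sub_cancel' him] at e
    · intro h
      refine ⟨concat n (fun i => x (m + i)) x, ⟨?_, ?_⟩, ?_, ?_⟩
      · exact fun i hi => (concat_add _ _ _ _).symm
      · exact fun i hi => by simp [concat, hi]
      · exact fun i hi => (concat_of_lt hi _ _).trans (h _ (by omega))
      · exact fun i hi => (concat_add _ _ _ _).trans (h _ (by omega))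
  | hexagon l m n =>
    intro x y
    rw [rel_cast]
    constructor
    · rintro ⟨h, h'⟩
      refine ⟨concat m (fun i => x (l + i)) (concat l x fun i => x (l + m + i)),
        ⟨⟨?_, ?_⟩, ?_⟩, ?_⟩
      · exact fun i hi => by rw [concat_add, concat_of_lt hi]
      · exact fun i hi => by rw [concat_of_lt hi]
      · intro i hi
        show _ = concat m _ _ (m + l + i)
        rw [Nat.add_assoc, concat_add, concat_add]
      · rw [rel_cast]
        refine ⟨fun i hi => ?_, fun i hi => ?_, fun i hi => ?_⟩
        · rw [concat_of_lt hi, h' i (by omega)]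
        · show concat m _ _ (m + i) = y (m + (n + i))
          rw [concat_add, concat_of_lt hi, h i hi, Nat.add_assoc]
        · show concat m _ _ (m + (l + i)) = y (m + i)
          rw [concat_add, concat_add, ← h' (m + i) (by omega), Nat.add_assoc]
    · rintro ⟨z, ⟨⟨h1, h2⟩, h3⟩, h4⟩
      rw [rel_cast] at h4
      obtain ⟨h4, h5, h6⟩ := h4
      refine ⟨fun i hi => ?_, fun i hi => ?_⟩
      · rw [h1 i hi, Nat.add_assoc]
        exact h5 i hi
      · rcases lt_or_ge i m with him | him
        · rw [h2 i him, h4 i him]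
        · have e3 := h3 (i - m) (by omega)
          have e6 := h6 (i - m) (by omega)
          simp only [Nat.add_assoc, Nat.add_sub_cancel' him] at e3 e6
          rw [e3, e6]
  | swap_unit n =>
    intro x y
    rw [rel_cast]
    simp [Term.rel]
  | mu_assoc c =>
    intro x y
    cases c
    · constructor
      · rintro ⟨z, h⟩
        refine ⟨label (x 0) (x 1) 0 0, ?_⟩
        simp [Term.rel, Gen.rel, label] at h ⊢
        grind
      · rintro ⟨z, h⟩
        refine ⟨label (x 0) (x 2) 0 0, ?_⟩
        simp [Term.rel, Gen.rel, label] at h ⊢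
        grind
    · constructor
      · rintro ⟨z, h⟩
        refine ⟨label (x 0) (x 1 + x 2) 0 0, ?_⟩
        simp [Term.rel, Gen.rel, label] at h ⊢
        grind
      · rintro ⟨z, h⟩
        refine ⟨label (x 0 + x 1) (x 2) 0 0, ?_⟩
        simp [Term.rel, Gen.rel, label] at h ⊢
        grind
  | mu_unit c =>
    intro x y
    cases c
    · constructor
      · rintro ⟨z, h⟩
        simp [Term.rel, Gen.rel] at h ⊢
        grind
      · intro h
        refine ⟨label (x 0) (x 0) 0 0, ?_⟩
        simp [Term.rel, Gen.rel, label] at h ⊢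
        grind
    · constructor
      · rintro ⟨z, h⟩
        simp [Term.rel, Gen.rel] at h ⊢
        grind
      · intro h
        refine ⟨label 0 (x 0) 0 0, ?_⟩
        simp [Term.rel, Gen.rel, label] at h ⊢
        grind
  | mu_comm c =>
    intro x y
    cases c <;> constructor
    · rintro ⟨z, h⟩
      simp [Term.rel, Gen.rel] at h ⊢
      grind
    · intro h
      refine ⟨label (x 1) (x 0) 0 0, ?_⟩
      simp [Term.rel, Gen.rel, label] at h ⊢
      grind
    · rintro ⟨z, h⟩
      simp [Term.rel, Gen.rel] at h ⊢
      grind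
    · intro h
      refine ⟨label (x 1) (x 0) 0 0, ?_⟩
      simp [Term.rel, Gen.rel, label] at h ⊢
      grind
  | frobenius_left c =>
    intro x y
    cases c <;> constructor
    · rintro ⟨z, h⟩
      refine ⟨label (x 0) 0 0 0, ?_⟩
      simp [Term.rel, Gen.rel, label] at h ⊢
      grind
    · rintro ⟨z, h⟩
      refine ⟨label (x 0) (x 0) (x 0) 0, ?_⟩
      simp [Term.rel, Gen.rel, label] at h ⊢
      grind
    · rintro ⟨z, h⟩
      refine ⟨label (x 0 + x 1) 0 0 0, ?_⟩
      simp [Term.rel, Gen.rel, label] at h ⊢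
      grind
    · rintro ⟨z, h⟩
      refine ⟨label (y 0) (x 0 - y 0) (x 1) 0, ?_⟩
      simp [Term.rel, Gen.rel, label] at h ⊢
      grind
  | frobenius_right c =>
    intro x y
    cases c <;> constructor
    · rintro ⟨z, h⟩
      refine ⟨label (x 0) 0 0 0, ?_⟩
      simp [Term.rel, Gen.rel, label] at h ⊢
      grind
    · rintro ⟨z, h⟩
      refine ⟨label (x 0) (x 0) (x 0) 0, ?_⟩
      simp [Term.rel, Gen.rel, label] at h ⊢
      grind
    · rintro ⟨z, h⟩
      refine ⟨label (x 0 + x 1) 0 0 0, ?_⟩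
      simp [Term.rel, Gen.rel, label] at h ⊢
      grind
    · rintro ⟨z, h⟩
      refine ⟨label (x 0) (x 1 - y 1) (y 1) 0, ?_⟩
      simp [Term.rel, Gen.rel, label] at h ⊢
      grind
  | special c =>
    intro x y
    cases c <;> constructor
    · rintro ⟨z, h⟩
      simp [Term.rel, Gen.rel] at h ⊢
      grind
    · intro h
      refine ⟨label (x 0) (x 0) 0 0, ?_⟩
      simp [Term.rel, Gen.rel, label] at h ⊢
      grind
    · rintro ⟨z, h⟩
      simp [Term.rel, Gen.rel] at h ⊢
      grind
    · intro h
      refine ⟨label 0 (x 0) 0 0, ?_⟩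
      simp [Term.rel, Gen.rel, label] at h ⊢
      grind
  | green_one =>
    intro x y
    simp [Term.rel, Gen.rel]
  | green_mul g g' =>
    intro x y
    constructor
    · rintro ⟨z, h⟩
      exact h.1.trans h.2
    · exact fun h => ⟨x, rfl, h⟩
  | green_mu g g' =>
    intro x y
    constructor
    · rintro ⟨z, h⟩
      refine ⟨label (x 0) 0 0 0, ?_⟩
      simp [Term.rel, Gen.rel, label] at h ⊢
      grind
    · rintro ⟨z, h⟩
      refine ⟨label (x 0) (x 1) 0 0, ?_⟩
      simp [Term.rel, Gen.rel, label] at h ⊢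
      grind
  | red_one =>
    intro x y
    simp [Term.rel, Gen.rel]
  | red_mul h h' =>
    intro x y
    constructor
    · rintro ⟨z, h⟩
      exact h.1.trans h.2
    · exact fun h => ⟨x, rfl, h⟩
  | red_mu h h' =>
    intro x y
    constructor
    · rintro ⟨z, h⟩
      refine ⟨label (x 0 + x 1) 0 0 0, ?_⟩
      simp [Term.rel, Gen.rel, label] at h ⊢
      grind
    · rintro ⟨z, h⟩
      refine ⟨label (x 0) (x 1) 0 0, ?_⟩
      simp [Term.rel, Gen.rel, label] at h ⊢
      grind
  | bialgebra =>
    intro x y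
    constructor
    · rintro ⟨z, h⟩
      refine ⟨label (x 0) (x 0) (x 1) (x 1), ?_, label (x 0) (x 1) (x 0) (x 1), ?_, ?_⟩ <;>
        simp [Term.rel, Gen.rel, label] at h ⊢
      grind
    · rintro ⟨z, h, w, h', h''⟩
      refine ⟨label (x 0 + x 1) 0 0 0, ?_⟩
      simp [Term.rel, Gen.rel, label] at h h' h'' ⊢
      grind
  | copy =>
    intro x y
    constructor
    · rintro ⟨z, h⟩
      simp [Term.rel, Gen.rel] at h ⊢
      grind
    · intro h
      refine ⟨label 0 0 0 0, ?_⟩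
      simp [Term.rel, Gen.rel, label] at h ⊢
      grind
  | cocopy =>
    intro x y
    constructor
    · rintro ⟨z, h⟩
      simp [Term.rel, Gen.rel]
    · intro h
      refine ⟨label (x 0 + x 1) 0 0 0, ?_⟩
      simp [Term.rel, Gen.rel, label]
  | bone =>
    intro x y
    constructor
    · rintro ⟨z, h⟩
      simp [Term.rel]
    · intro h
      refine ⟨label 0 0 0 0, ?_⟩
      simp [Term.rel, Gen.rel, label]
  | green_unit_real =>
    intro x y
    constructor
    · rintro ⟨z, h⟩
      simp [Term.rel, Gen.rel]
    · intro h
      refine ⟨label (- x 0) (x 0) 0 0, ?_, label 0 0 0 0, ?_⟩ <;>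
        simp [Term.rel, Gen.rel, label]
  | red_unit_real =>
    intro x y
    constructor
    · rintro ⟨z, ⟨w, h⟩, h'⟩
      simp [Term.rel, Gen.rel] at h h' ⊢
      grind
    · intro h
      refine ⟨label 0 0 0 0, ⟨label 0 0 0 0, ?_⟩, ?_⟩ <;>
        simp [Term.rel, Gen.rel, label] at h ⊢
      grind

namespace IF

variable {G H : Type*} [CommGroup G] [CommGroup H]

open scoped MonObj ComonObj HopfObj
open Colour

/-! ### Matrices of morphisms of the Hopf algebra -/

/-- The relation on integer labellings denoted by a morphism. -/
def rel {X Y : IF G H} (f : X ⟶ Y) : (ℕ → ℤ) → (ℕ → ℤ) → Prop :=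
  Quotient.lift Term.rel (fun _ _ h => funext₂ fun x y => propext (Eqv.rel h x y)) f

theorem rel_comp {X Y Z : IF G H} (f : X ⟶ Y) (g : Y ⟶ Z) (x y : ℕ → ℤ) :
    rel (f ≫ g) x y ↔ ∃ z, rel f x z ∧ rel g z y := by
  obtain ⟨f, rfl⟩ := eq_ofTerm f
  obtain ⟨g, rfl⟩ := eq_ofTerm g
  rfl

theorem rel_tensor {m n m' n' : ℕ} (f : (⟨m⟩ : IF G H) ⟶ ⟨n⟩) (g : (⟨m'⟩ : IF G H) ⟶ ⟨n'⟩)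
    (x y : ℕ → ℤ) : rel (tensor f g) x y ↔
      rel f x y ∧ rel g (fun i => x (m + i)) (fun i => y (n + i)) := by
  obtain ⟨f, rfl⟩ := ofTerm_surjective f
  obtain ⟨g, rfl⟩ := ofTerm_surjective g
  rfl

theorem rel_id {X : IF G H} (x y : ℕ → ℤ) : rel (𝟙 X) x y ↔ ∀ i < X.wires, x i = y i :=
  Iff.rfl

/-- A morphism is represented by an integer matrix if it acts on tuples of points, at every
stage, as this matrix does. -/
def Represents {X Y : IF G H} (f : X ⟶ Y) (A : Matrix (Fin Y.wires) (Fin X.wires) ℤ) : Prop :=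
  ∀ (K : CommComon (IF G H)) (p : Fin X.wires → Points K.X (wire G H)),
    tuple p ≫ f = tuple (act A p)

/-- A morphism represented by a matrix is determined by it. -/
theorem Represents.unique {X Y : IF G H} {f g : X ⟶ Y}
    {A : Matrix (Fin Y.wires) (Fin X.wires) ℤ} (hf : Represents f A) (hg : Represents g A) :
    f = g := by
  -- At the generic stage a tuple of points is invertible, so that it can be cancelled.
  obtain ⟨K, p, hp⟩ := exists_tuple_isIso G H X.wires
  exact (cancel_epi (X := K.X) (Y := X) (tuple p)).1 ((hf K p).trans (hg K p).symm)

theorem Represents.id (X : IF G H) : Represents (𝟙 X) 1 := fun K p => by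
  rw [act_one]
  exact Category.comp_id _

theorem Represents.comp {X Y Z : IF G H} {f : X ⟶ Y} {g : Y ⟶ Z}
    {A : Matrix (Fin Y.wires) (Fin X.wires) ℤ} {B : Matrix (Fin Z.wires) (Fin Y.wires) ℤ}
    (hf : Represents f A) (hg : Represents g B) : Represents (f ≫ g) (B * A) := fun K p => by
  rw [act_mul, ← hg, ← hf]
  exact (Category.assoc _ _ _).symm

theorem Represents.tensor {m n m' n' : ℕ} {f : (⟨m⟩ : IF G H) ⟶ ⟨n⟩}
    {g : (⟨m'⟩ : IF G H) ⟶ ⟨n'⟩} {A : Matrix (Fin n) (Fin m) ℤ} {B : Matrix (Fin n') (Fin m') ℤ}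
    (hf : Represents f A) (hg : Represents g B) :
    Represents (tensor f g) (blockSum A B) := fun K p => by
  change Fin (m + m') → _ at p
  rw [← Fin.append_castAdd_natAdd (f := p)]
  generalize (fun i => p (Fin.castAdd m' i)) = q
  generalize (fun i => p (Fin.natAdd m i)) = q'
  refine Eq.trans ?_ (congrArg tuple (act_blockSum A B q q')).symm
  refine Eq.trans ?_ (tuple_append _ _).symm
  rw [← show _ = tuple (act A q) from hf K q, ← show _ = tuple (act B q') from hg K q']
  refine (congrArg (fun t => t ≫ (f ⊗ₘ g)) (tuple_append q q')).trans ?_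
  rw [Category.assoc, tensorHom_comp_tensorHom]

theorem Represents.swap (m n : ℕ) :
    Represents (ofTerm (Term.swap m n : Term G H _ _)) (reindexMatrix finAddFlip) := fun K p => by
  change Fin (m + n) → _ at p
  rw [← Fin.append_castAdd_natAdd (f := p)]
  generalize (fun i => p (Fin.castAdd n i)) = q
  generalize (fun i => p (Fin.natAdd m i)) = q'
  have h : act (reindexMatrix finAddFlip) (Fin.append q q') = Fin.append q' q := by
    rw [act_reindexMatrix]
    ext i
    refine Fin.addCases (fun i => ?_) (fun i => ?_) i <;> simp
  refine Eq.trans ?_ (congrArg tuple h).symm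
  refine Eq.trans ?_ (tuple_append _ _).symm
  refine (congrArg (fun t => t ≫ (β_ (⟨m⟩ : IF G H) ⟨n⟩).hom) (tuple_append q q')).trans ?_
  rw [Category.assoc, BraidedCategory.braiding_naturality, IsCommComonObj.comul_comm_assoc]

theorem Represents.antipode : Represents (ofTerm (Term.antipode : Term G H 1 1)) (-1) :=
  fun K p => by
    change Fin 1 → _ at p
    rw [act_neg_one]
    refine Eq.trans ?_ (tuple_one _).symm
    refine (congrArg₂ (fun s t => s ≫ t) (tuple_one p) ofTerm_antipode).trans ?_
    rfl

theorem Represents.delta : Represents (ofTerm (Term.delta green : Term G H 1 2))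
    (reindexMatrix fun _ => 0) := fun K p => by
  change Fin 1 → _ at p
  rw [act_reindexMatrix]
  refine Eq.trans ?_ (tuple_two _).symm
  refine (congrArg (fun s => s ≫ Δ[wire G H]) (tuple_one p)).trans ?_
  exact IsComonHom.hom_comul _

theorem Represents.eps : Represents (ofTerm (Term.eps green : Term G H 1 0))
    (reindexMatrix Fin.elim0) := fun K p => by
  change Fin 1 → _ at p
  refine (congrArg (fun s => s ≫ ε[wire G H]) (tuple_one p)).trans ?_
  exact IsComonHom.hom_counit _

theorem Represents.mu : Represents (ofTerm (Term.mu red : Term G H 2 1))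
    (Matrix.of fun _ _ => 1) := fun K p => by
  change Fin 2 → _ at p
  refine Eq.trans ?_ (tuple_one _).symm
  have h : act (Matrix.of fun (_ : Fin 1) (_ : Fin 2) => 1) p 0 = p 0 + p 1 := by
    simp [act]
  refine Eq.trans ?_ (congrArg Points.val h).symm
  refine (congrArg (fun s => s ≫ μ[wire G H]) (tuple_two p)).trans ?_
  exact Category.assoc _ _ _

theorem Represents.eta : Represents (ofTerm (Term.eta red : Term G H 0 1)) 0 := fun K p => by
  change Fin 0 → _ at p
  refine Eq.trans ?_ (tuple_one _).symm
  have h : act (0 : Matrix (Fin 1) (Fin 0) ℤ) p 0 = 0 := by simp [act]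
  exact (congrArg Points.val h).symm

/-- The relation denoted by a morphism is the graph of an integer matrix. -/
def IsGraph {X Y : IF G H} (f : X ⟶ Y) (A : Matrix (Fin Y.wires) (Fin X.wires) ℤ) : Prop :=
  ∀ x y : ℕ → ℤ, rel f x y ↔ (fun i : Fin Y.wires => y i) = act A (fun i : Fin X.wires => x i)

theorem IsGraph.comp {X Y Z : IF G H} {f : X ⟶ Y} {g : Y ⟶ Z}
    {A : Matrix (Fin Y.wires) (Fin X.wires) ℤ} {B : Matrix (Fin Z.wires) (Fin Y.wires) ℤ}
    (hf : IsGraph f A) (hg : IsGraph g B) : IsGraph (f ≫ g) (B * A) := fun x y => by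
  rw [rel_comp, act_mul]
  constructor
  · rintro ⟨z, hz, h⟩
    rw [← (hf x z).1 hz]
    exact (hg z y).1 h
  · intro h
    let z : ℕ → ℤ := fun i =>
      if hi : i < Y.wires then act A (fun i : Fin X.wires => x i) ⟨i, hi⟩ else 0
    have hz : (fun i : Fin Y.wires => z i) = act A (fun i : Fin X.wires => x i) := by
      ext i
      simp [z]
    exact ⟨z, (hf x z).2 hz, (hg z y).2 (by rw [hz, h])⟩

theorem IsGraph.tensor {m n m' n' : ℕ} {f : (⟨m⟩ : IF G H) ⟶ ⟨n⟩}
    {g : (⟨m'⟩ : IF G H) ⟶ ⟨n'⟩} {A : Matrix (Fin n) (Fin m) ℤ} {B : Matrix (Fin n') (Fin m') ℤ}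
    (hf : IsGraph f A) (hg : IsGraph g B) :
    IsGraph (IF.tensor f g) (blockSum A B) := fun x y => by
  rw [rel_tensor, hf, hg]
  have key : ∀ (a b : ℕ) (w : ℕ → ℤ), (fun i : Fin (a + b) => w i) =
      Fin.append (fun i : Fin a => w i) (fun i : Fin b => w (a + i)) := by
    intro a b w
    ext i
    refine Fin.addCases (fun i => ?_) (fun i => ?_) i <;> simp
  change _ ↔ (fun i : Fin (n + n') => y i) = act (blockSum A B) (fun i : Fin (m + m') => x i)
  rw [key n n' y, key m m' x, act_blockSum]
  constructor
  · rintro ⟨h, h'⟩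
    rw [← h, ← h']
  · intro h
    exact ⟨funext fun i => by simpa using congrFun h (Fin.castAdd n' i),
      funext fun i => by simpa using congrFun h (Fin.natAdd n i)⟩

/-- A morphism of `HA` has an integer matrix, which describes both its action on points and the
relation it denotes. -/
theorem exists_matrix {X Y : IF G H} {f : X ⟶ Y} (hf : HA f) :
    ∃ A : Matrix (Fin Y.wires) (Fin X.wires) ℤ, Represents f A ∧ IsGraph f A := by
  induction hf with
  | of f hf =>
    cases hf with
    | delta =>
      refine ⟨_, Represents.delta, fun x y => ?_⟩
      change (y 0 = x 0 ∧ y 1 = x 0) ↔ (fun i : Fin 2 => y i) = act _ (fun i : Fin 1 => x i)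
      rw [act_reindexMatrix, funext_iff, Fin.forall_fin_two]
      rfl
    | eps =>
      refine ⟨_, Represents.eps, fun x y => ?_⟩
      exact iff_of_true trivial (funext fun i => Fin.elim0 i)
    | mu =>
      refine ⟨_, Represents.mu, fun x y => ?_⟩
      change x 0 + x 1 = y 0 ↔ (fun i : Fin 1 => y i) = act _ (fun i : Fin 2 => x i)
      rw [funext_iff, Fin.forall_fin_one]
      simp [act, eq_comm]
    | eta =>
      refine ⟨_, Represents.eta, fun x y => ?_⟩
      change y 0 = 0 ↔ (fun i : Fin 1 => y i) = act _ (fun i : Fin 0 => x i)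
      rw [funext_iff, Fin.forall_fin_one]
      simp [act]
    | antipode =>
      refine ⟨_, Represents.antipode, fun x y => ?_⟩
      change Term.rel Term.antipode x y ↔ (fun i : Fin 1 => y i) = act (-1) (fun i : Fin 1 => x i)
      rw [act_neg_one, funext_iff, Fin.forall_fin_one]
      constructor
      · rintro ⟨z, ⟨h, w, h'⟩, ⟨v, h''⟩, h'''⟩
        simp [Term.rel, Gen.rel] at h h' h'' h''' ⊢
        grind
      · intro h
        refine ⟨Term.label (x 0) (x 0) (y 0) 0, ⟨?_, Term.label 0 0 0 0, ?_⟩,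
          ⟨Term.label (x 0) 0 0 0, ?_⟩, ?_⟩ <;>
        simp [Term.rel, Gen.rel, Term.label] at h ⊢
        grind
  | id X =>
    refine ⟨1, Represents.id X, fun x y => ?_⟩
    rw [act_one, rel_id, funext_iff]
    exact ⟨fun h i => (h i i.2).symm, fun h i hi => (h ⟨i, hi⟩).symm⟩
  | swap m n =>
    refine ⟨_, Represents.swap m n, fun x y => ?_⟩
    change Term.rel (Term.swap m n : Term G H _ _) x y ↔
      (fun i : Fin (n + m) => y i) = act _ (fun i : Fin (m + n) => x i)
    rw [act_reindexMatrix]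
    constructor
    · rintro ⟨h, h'⟩
      ext i
      refine Fin.addCases (fun i => ?_) (fun i => ?_) i
      · simpa using (h' i i.2).symm
      · simpa using (h i i.2).symm
    · intro h
      refine ⟨fun i hi => ?_, fun i hi => ?_⟩
      · simpa using (congrFun h (Fin.natAdd n ⟨i, hi⟩)).symm
      · have h' := congrFun h (Fin.castAdd m ⟨i, hi⟩)
        rw [Function.comp_apply, finAddFlip_apply_castAdd] at h'
        exact h'.symm
  | comp f g _ _ ihf ihg =>
    obtain ⟨A, hA, hA'⟩ := ihf
    obtain ⟨B, hB, hB'⟩ := ihg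
    exact ⟨B * A, hA.comp hB, hA'.comp hB'⟩
  | tensor f g _ _ ihf ihg =>
    obtain ⟨A, hA, hA'⟩ := ihf
    obtain ⟨B, hB, hB'⟩ := ihg
    exact ⟨blockSum A B, hA.tensor hB, hA'.tensor hB'⟩

end IF

/-! ### Generation of the invertible integer matrices -/

section Generation

/-- On integer vectors, `act` is the usual product of a matrix with a vector. -/
theorem matrix_ext {m n : ℕ} {A B : Matrix (Fin m) (Fin n) ℤ}
    (h : ∀ p : Fin n → ℤ, act A p = act B p) : A = B :=
  Matrix.mulVec_injective (funext h)

theorem append_append_singleton {n : ℕ} (x : Fin n → ℤ) (a b : ℤ) :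
    Fin.append (Fin.append x ![a]) ![b] = (Fin.append x ![a, b] : Fin (n + 2) → ℤ) := by
  ext i
  refine Fin.addCases (m := n) (n := 2) (fun i => ?_) (fun i => ?_) i
  · rw [Fin.append_left]
    exact (Fin.append_left _ _ (Fin.castAdd 1 i)).trans (Fin.append_left _ _ i)
  · rw [Fin.append_right]
    fin_cases i
    · exact (Fin.append_left _ _ (Fin.natAdd n (0 : Fin 1))).trans (Fin.append_right _ _ 0)
    · exact Fin.append_right _ _ (0 : Fin 1)

theorem exists_append {m n : ℕ} (p : Fin (m + n) → ℤ) :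
    ∃ (x : Fin m → ℤ) (y : Fin n → ℤ), p = Fin.append x y :=
  ⟨_, _, Fin.append_castAdd_natAdd.symm⟩

theorem blockSum_mul {m n : ℕ} (A A' : Matrix (Fin m) (Fin m) ℤ) (B B' : Matrix (Fin n) (Fin n) ℤ) :
    blockSum A B * blockSum A' B' = blockSum (A * A') (B * B') := by
  refine matrix_ext fun p => ?_
  obtain ⟨x, y, rfl⟩ := exists_append p
  simp only [act_mul, act_blockSum]

theorem blockSum_one (m n : ℕ) :
    blockSum (1 : Matrix (Fin m) (Fin m) ℤ) (1 : Matrix (Fin n) (Fin n) ℤ) = 1 := by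
  refine matrix_ext fun p => ?_
  obtain ⟨x, y, rfl⟩ := exists_append p
  simp only [act_one, act_blockSum]

theorem isUnit_blockSum {m n : ℕ} {A : Matrix (Fin m) (Fin m) ℤ} {B : Matrix (Fin n) (Fin n) ℤ}
    (hA : IsUnit A) (hB : IsUnit B) : IsUnit (blockSum A B) := by
  rw [isUnit_iff_exists] at *
  obtain ⟨A', h1, h2⟩ := hA
  obtain ⟨B', h3, h4⟩ := hB
  exact ⟨blockSum A' B', by rw [blockSum_mul, h1, h3, blockSum_one],
    by rw [blockSum_mul, h2, h4, blockSum_one]⟩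

/-- The exchange of two coordinates. -/
def swapMatrix : Matrix (Fin 2) (Fin 2) ℤ := !![0, 1; 1, 0]

/-- The shear adding `c` times the first coordinate to the second one. -/
def shearTwo (c : ℤ) : Matrix (Fin 2) (Fin 2) ℤ := !![1, 0; c, 1]

/-- The shear adding a linear combination of the first `n` coordinates to the last one. -/
def shear {n : ℕ} (w : Fin n → ℤ) : Matrix (Fin (n + 1)) (Fin (n + 1)) ℤ :=
  Matrix.reindex finSumFinEquiv finSumFinEquiv (Matrix.fromBlocks 1 0 (Matrix.of fun _ => w) 1)

theorem act_swapMatrix (a b : ℤ) : act swapMatrix ![a, b] = ![b, a] := by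
  ext i
  fin_cases i <;> simp [act, swapMatrix]

theorem act_shearTwo (c a b : ℤ) : act (shearTwo c) ![a, b] = ![a, c * a + b] := by
  ext i
  fin_cases i <;> simp [act, shearTwo]

theorem act_shear {n : ℕ} (w x : Fin n → ℤ) (a : ℤ) :
    act (shear w) (Fin.append x ![a]) = Fin.append x ![∑ j, w j * x j + a] := by
  ext i
  refine Fin.addCases (fun i => ?_) (fun i => ?_) i
  · simp [act, shear, Fin.sum_univ_add, Matrix.one_apply]
  · fin_cases i
    simp [act, shear, Fin.sum_univ_add]

/-- A family of submonoids of the matrix rings that is closed under block sums and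
contains the sign, the swap and a shear. By `GeneratingFamily.mem_of_isUnit` it contains all
invertible matrices. -/
structure GeneratingFamily (R : ∀ n : ℕ, Submonoid (Matrix (Fin n) (Fin n) ℤ)) : Prop where
  blockSum_mem : ∀ {m n : ℕ} {A : Matrix (Fin m) (Fin m) ℤ} {B : Matrix (Fin n) (Fin n) ℤ},
    A ∈ R m → B ∈ R n → blockSum A B ∈ R (m + n)
  neg_one_mem : -1 ∈ R 1
  swapMatrix_mem : swapMatrix ∈ R 2
  shearTwo_mem : shearTwo (-1) ∈ R 2

namespace GeneratingFamily

variable {R : ∀ n : ℕ, Submonoid (Matrix (Fin n) (Fin n) ℤ)} (hR : GeneratingFamily R)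

include hR

theorem shearTwo_mem' (c : ℤ) : shearTwo c ∈ R 2 := by
  have hadd : ∀ a b, shearTwo (a + b) = shearTwo a * shearTwo b := by
    intro a b
    simp [shearTwo]
  have hzero : shearTwo 0 ∈ R 2 := by
    have : shearTwo 0 = 1 := by simp [shearTwo, Matrix.one_fin_two]
    exact this ▸ one_mem _
  have hpos : shearTwo 1 ∈ R 2 := by
    have h : blockSum (-1 : Matrix (Fin 1) (Fin 1) ℤ) (1 : Matrix (Fin 1) (Fin 1) ℤ) ∈ R 2 :=
      hR.blockSum_mem hR.neg_one_mem (one_mem (R 1))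
    -- Conjugation by a sign inverts the shear.
    have e : shearTwo 1 = (blockSum (-1) 1 : Matrix (Fin (1 + 1)) (Fin (1 + 1)) ℤ) *
        shearTwo (-1) * (blockSum (-1) 1 : Matrix (Fin (1 + 1)) (Fin (1 + 1)) ℤ) := by
      decide
    rw [e]
    exact mul_mem (mul_mem h hR.shearTwo_mem) h
  induction c with
  | zero => exact hzero
  | succ i ih => exact hadd _ _ ▸ mul_mem ih hpos
  | pred i ih => exact hadd _ _ ▸ mul_mem ih hR.shearTwo_mem

theorem shear_mem {n : ℕ} (w : Fin n → ℤ) : shear w ∈ R (n + 1) := by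
  induction n with
  | zero =>
    have : shear w = 1 := by
      refine matrix_ext fun p => ?_
      obtain ⟨x, y, rfl⟩ := exists_append p
      obtain ⟨a, rfl⟩ : ∃ a, y = ![a] := ⟨y 0, by ext i; fin_cases i; rfl⟩
      rw [act_shear]
      simp
    exact this ▸ one_mem _
  | succ n ih =>
    obtain ⟨w, e, rfl⟩ := exists_append w
    -- The shear by `w` reaches the last coordinate past coordinate `n` by two swaps.
    have h : shear (Fin.append w e) = (blockSum (1 : Matrix (Fin n) (Fin n) ℤ) (shearTwo (e 0)) *
        blockSum (1 : Matrix (Fin n) (Fin n) ℤ) swapMatrix) *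
        (blockSum (shear w) (1 : Matrix (Fin 1) (Fin 1) ℤ) *
        blockSum (1 : Matrix (Fin n) (Fin n) ℤ) swapMatrix) := by
      refine matrix_ext fun p => ?_
      obtain ⟨x, y, rfl⟩ := exists_append (m := n) (n := 2) p
      obtain ⟨a, b, rfl⟩ : ∃ a b, y = ![a, b] := ⟨y 0, y 1, by ext i; fin_cases i <;> rfl⟩
      have hswap : ∀ a b : ℤ, act (blockSum (1 : Matrix (Fin n) (Fin n) ℤ) swapMatrix)
          (Fin.append x ![a, b]) = Fin.append x ![b, a] := by
        intro a b
        rw [act_blockSum, act_one, act_swapMatrix]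
      have hshear : act (blockSum (shear w) (1 : Matrix (Fin 1) (Fin 1) ℤ))
          (Fin.append x ![b, a] : Fin (n + 2) → ℤ) = Fin.append x ![∑ j, w j * x j + b, a] := by
        rw [← append_append_singleton, ← append_append_singleton]
        refine (act_blockSum _ _ _ _).trans ?_
        rw [act_one, act_shear]
      have hleft : act (shear (Fin.append w e)) (Fin.append x ![a, b] : Fin (n + 2) → ℤ) =
          Fin.append x ![a, e 0 * a + (∑ j, w j * x j + b)] := by
        rw [← append_append_singleton, ← append_append_singleton]
        refine (act_shear _ _ _).trans ?_
        congr 2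
        simp [Fin.sum_univ_add]
        ring
      refine hleft.trans ?_
      rw [act_mul, act_mul, act_mul]
      symm
      refine (congrArg _ (congrArg _ (congrArg _ (hswap a b)))).trans ?_
      refine (congrArg _ (congrArg _ hshear)).trans ?_
      refine (congrArg _ (hswap _ _)).trans ?_
      rw [act_blockSum, act_one, act_shearTwo]
    rw [h]
    have h1 : blockSum (1 : Matrix (Fin n) (Fin n) ℤ) swapMatrix ∈ R (n + 2) :=
      hR.blockSum_mem (one_mem _) hR.swapMatrix_mem
    have h2 : blockSum (1 : Matrix (Fin n) (Fin n) ℤ) (shearTwo (e 0)) ∈ R (n + 2) :=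
      hR.blockSum_mem (one_mem _) (hR.shearTwo_mem' _)
    have h3 : blockSum (shear w) (1 : Matrix (Fin 1) (Fin 1) ℤ) ∈ R (n + 2) :=
      hR.blockSum_mem (ih w) (one_mem (R 1))
    exact mul_mem (mul_mem h2 h1) (mul_mem h3 h1)

/-- Euclid's algorithm: every pair of integers is obtained from a pair `(0, d)`. -/
theorem exists_act_pair (a b : ℤ) : ∃ B ∈ R 2, IsUnit B ∧ ∃ d, act B ![0, d] = ![a, b] := by
  induction h : a.natAbs using Nat.strong_induction_on generalizing a b with
  | _ k ih =>
    rcases eq_or_ne a 0 with rfl | ha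
    · exact ⟨1, one_mem _, isUnit_one, b, act_one _⟩
    · have hlt : (b % a).natAbs < k := by
        have := Int.emod_lt_abs b ha
        rw [Int.abs_eq_natAbs] at this
        have := Int.emod_nonneg b ha
        omega
      obtain ⟨B, hB, hB', d, hd⟩ := ih _ hlt (b % a) a rfl
      refine ⟨shearTwo (b / a) * (swapMatrix * B), mul_mem (hR.shearTwo_mem' _)
        (mul_mem hR.swapMatrix_mem hB), ?_, d, ?_⟩
      · refine IsUnit.mul ?_ (IsUnit.mul ?_ hB') <;>
          simp [Matrix.isUnit_iff_isUnit_det, shearTwo, swapMatrix, Matrix.det_fin_two]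
      · rw [act_mul, act_mul, hd, act_swapMatrix, act_shearTwo, mul_comm, Int.mul_ediv_add_emod]

/-- Every integer vector is obtained from one that is supported on the last coordinate. -/
theorem exists_act_last {n : ℕ} (v : Fin (n + 1) → ℤ) :
    ∃ B ∈ R (n + 1), IsUnit B ∧ ∃ d, act B (Fin.append 0 ![d]) = v := by
  induction n with
  | zero =>
    refine ⟨1, one_mem _, isUnit_one, v 0, ?_⟩
    rw [act_one]
    ext i
    fin_cases i
    rfl
  | succ n ih =>
    obtain ⟨v, b, rfl⟩ := exists_append v
    obtain ⟨b, rfl⟩ : ∃ c, b = ![c] := ⟨b 0, by ext i; fin_cases i; rfl⟩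
    obtain ⟨B, hB, hB', a, rfl⟩ := ih v
    obtain ⟨C, hC, hC', d, hd⟩ := hR.exists_act_pair a b
    have h1 : blockSum B (1 : Matrix (Fin 1) (Fin 1) ℤ) ∈ R (n + 2) :=
      hR.blockSum_mem hB (one_mem (R 1))
    have h2 : blockSum (1 : Matrix (Fin n) (Fin n) ℤ) C ∈ R (n + 2) :=
      hR.blockSum_mem (one_mem _) hC
    refine ⟨_, mul_mem h1 h2, (isUnit_blockSum hB' isUnit_one).mul
      (isUnit_blockSum isUnit_one hC'), d, ?_⟩
    have h3 : act (blockSum (1 : Matrix (Fin n) (Fin n) ℤ) C) (Fin.append 0 ![0, d]) =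
        Fin.append (Fin.append 0 ![a]) ![b] := by
      rw [act_blockSum, act_one, hd]
      exact (append_append_singleton _ _ _).symm
    have h4 : (Fin.append 0 ![d] : Fin (n + 1 + 1) → ℤ) = Fin.append (0 : Fin n → ℤ) ![0, d] := by
      rw [← append_append_singleton]
      congr 1
      ext i
      refine Fin.addCases (fun i => ?_) (fun i => ?_) i
      · simp
      · fin_cases i
        simp
    rw [act_mul]
    refine (congrArg _ ((congrArg _ h4).trans h3)).trans ?_
    refine (act_blockSum _ _ _ _).trans ?_
    rw [act_one]

theorem mem_of_isUnit {n : ℕ} {A : Matrix (Fin n) (Fin n) ℤ} (hA : IsUnit A) : A ∈ R n := by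
  induction n with
  | zero => exact Subsingleton.elim 1 A ▸ one_mem _
  | succ n ih =>
    obtain ⟨B, hB, hB', d, hd⟩ := hR.exists_act_last (act A (Fin.append 0 ![1]))
    obtain ⟨B, rfl⟩ := hB'
    -- The last column of `A₁` is supported on the diagonal, so `A₁` is block triangular.
    set A₁ : Matrix (Fin (n + 1)) (Fin (n + 1)) ℤ := B⁻¹.val * A with hA₁
    have hAB : A = B * A₁ := by rw [hA₁, ← mul_assoc, Units.mul_inv, one_mul]
    have hu : IsUnit A₁ := (Units.isUnit _).mul hA
    have hlast : act A₁ (Fin.append 0 ![1]) = Fin.append 0 ![d] := by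
      rw [hA₁, act_mul, ← hd, ← act_mul, Units.inv_mul, act_one]
    rw [hAB]
    refine mul_mem hB ?_
    clear_value A₁
    obtain ⟨M, rfl⟩ := (Matrix.reindex finSumFinEquiv finSumFinEquiv).surjective A₁
    rw [← Matrix.fromBlocks_toBlocks M] at hu hlast ⊢
    generalize M.toBlocks₁₁ = P at *
    generalize M.toBlocks₁₂ = Q at *
    generalize M.toBlocks₂₁ = W at *
    generalize M.toBlocks₂₂ = D at *
    have hQ : Q = 0 := by
      ext i j
      have := congrFun hlast (Fin.castAdd 1 i)
      fin_cases j
      simpa [act, Fin.sum_univ_add] using this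
    subst hQ
    have hdet : IsUnit (P.det * D.det) := by
      rw [Matrix.isUnit_iff_isUnit_det, Matrix.det_reindex_self,
        Matrix.det_fromBlocks_zero₁₂] at hu
      exact hu
    have hP : IsUnit P := P.isUnit_iff_isUnit_det.2 (isUnit_of_mul_isUnit_left hdet)
    have hD := isUnit_of_mul_isUnit_right hdet
    have hDR : D ∈ R 1 ∧ D * D = 1 := by
      have hD1 : D = D.det • 1 := by
        ext i j
        fin_cases i; fin_cases j
        simp
      rcases Int.isUnit_iff.1 hD with h | h <;> rw [h] at hD1 <;> subst hD1
      · simp [one_mem]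
      · simpa using hR.neg_one_mem
    have e : Matrix.reindex finSumFinEquiv finSumFinEquiv (Matrix.fromBlocks P 0 W D) =
        blockSum P D * shear ((D * W) 0) := by
      have hW : (Matrix.of fun (_ : Fin 1) => (D * W) 0) = D * W := by
        ext i j
        fin_cases i
        rfl
      rw [blockSum, shear, hW]
      simp only [Matrix.reindex_apply, Matrix.submatrix_mul_equiv, Matrix.fromBlocks_multiply]
      simp [← Matrix.mul_assoc, hDR.2]
    rw [e]
    exact mul_mem (hR.blockSum_mem (ih hP) hDR.1) (hR.shear_mem _)

end GeneratingFamily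

end Generation

namespace IF

variable {G H : Type*} [CommGroup G] [CommGroup H]

open scoped MonObj ComonObj HopfObj
open Colour

/-! ### Invertible matrices in the opposite Hopf algebra -/

variable (G H) in
/-- The square matrices that represent a morphism of the opposite Hopf algebra. -/
def opMatrices (n : ℕ) : Submonoid (Matrix (Fin n) (Fin n) ℤ) where
  carrier := {A | ∃ f : (⟨n⟩ : IF G H) ⟶ ⟨n⟩, HAOp f ∧ Represents f A}
  one_mem' := ⟨𝟙 _, Generated.id _, Represents.id _⟩
  mul_mem' := by
    rintro A B ⟨f, hf, hfA⟩ ⟨g, hg, hgB⟩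
    exact ⟨g ≫ f, Generated.comp g f hg hf, hgB.comp hfA⟩

/-- The antipode equals its dagger, which generates `HAOp`. -/
theorem haOp_antipode : HAOp (ofTerm (Term.antipode : Term G H 1 1)) := by
  rw [ofTerm_antipode, ← ofTerm_dagger_antipode]
  exact Generated.of _ HAOpGen.antipode

/-- The morphism of `HA` that subtracts the first coordinate from the second one. -/
def subShear : (⟨2⟩ : IF G H) ⟶ ⟨2⟩ :=
  (tensor (ofTerm (Term.delta green)) (𝟙 (wire G H)) : (⟨2⟩ : IF G H) ⟶ ⟨3⟩) ≫
    (tensor (𝟙 (wire G H)) ((tensor (ofTerm Term.antipode) (𝟙 (wire G H)) : (⟨2⟩ : IF G H) ⟶ ⟨2⟩) ≫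
      ofTerm (Term.mu red)) : (⟨3⟩ : IF G H) ⟶ ⟨2⟩)

theorem represents_subShear : Represents (subShear : (⟨2⟩ : IF G H) ⟶ ⟨2⟩) (shearTwo (-1)) := by
  have h1 := (Represents.delta (G := G) (H := H)).tensor (Represents.id (wire G H))
  have h2 := (Represents.id (wire G H)).tensor
    ((Represents.antipode.tensor (Represents.id (wire G H))).comp
      (Y := ⟨2⟩) Represents.mu)
  have h := h1.comp (Y := ⟨3⟩) h2
  have e : (blockSum (1 : Matrix (Fin 1) (Fin 1) ℤ)
      ((Matrix.of fun (_ : Fin 1) (_ : Fin 2) => (1 : ℤ)) *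
        (blockSum (-1) 1 : Matrix (Fin (1 + 1)) (Fin (1 + 1)) ℤ)) :
          Matrix (Fin (1 + 1)) (Fin (1 + 2)) ℤ) *
      (blockSum (reindexMatrix fun (_ : Fin 2) => (0 : Fin 1)) (1 : Matrix (Fin 1) (Fin 1) ℤ) :
        Matrix (Fin (2 + 1)) (Fin (1 + 1)) ℤ) = shearTwo (-1) := by
    decide
  exact Eq.mp (congrArg (Represents _) e) h

/-- The same morphism, expressed in the opposite Hopf algebra. -/
theorem subShear_eq : (subShear : (⟨2⟩ : IF G H) ⟶ ⟨2⟩) =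
    (tensor (𝟙 (wire G H)) (ofTerm (Term.delta red)) : (⟨2⟩ : IF G H) ⟶ ⟨3⟩) ≫
      (tensor (ofTerm (Term.mu green)) (𝟙 (wire G H)) : (⟨3⟩ : IF G H) ⟶ ⟨2⟩) := by
  have h := shear_eq_of_bend (comul_eq_left (G := G) (H := H) red)
    (mul_eq_left (G := G) (H := H) green)
  refine Eq.trans ?_ (h.trans ?_)
  · refine congrArg (CategoryStruct.comp (comul green ▷ wire G H)) ?_
    refine Eq.trans ?_ (Category.id_comp _).symm
    exact congrArg (fun s : wire G H ⟶ wire G H => wire G H ◁ (s ▷ wire G H ≫ mul red))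
      ofTerm_antipode_eq_bendRight
  · exact congrArg (CategoryStruct.comp (wire G H ◁ comul red)) (Category.id_comp _)

theorem haOp_subShear : HAOp (subShear : (⟨2⟩ : IF G H) ⟶ ⟨2⟩) := by
  rw [subShear_eq]
  exact Generated.comp _ _
    (Generated.tensor _ _ (Generated.id _) (Generated.of _ HAOpGen.delta))
    (Generated.tensor _ _ (Generated.of _ HAOpGen.mu) (Generated.id _))

variable (G H) in
theorem generatingFamily_opMatrices : GeneratingFamily (opMatrices G H) where
  blockSum_mem := by
    rintro m n A B ⟨f, hf, hfA⟩ ⟨g, hg, hgB⟩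
    exact ⟨tensor f g, Generated.tensor f g hf hg, hfA.tensor hgB⟩
  neg_one_mem := ⟨_, haOp_antipode, Represents.antipode⟩
  swapMatrix_mem := by
    refine ⟨ofTerm (Term.swap 1 1), Generated.swap 1 1, ?_⟩
    have h : reindexMatrix (finAddFlip (m := 1) (n := 1)) = swapMatrix := by decide
    exact h ▸ Represents.swap 1 1
  shearTwo_mem := ⟨subShear, haOp_subShear, represents_subShear⟩

/-! ### Invertible morphisms -/

theorem exists_label {n : ℕ} (v : Fin n → ℤ) : ∃ x : ℕ → ℤ, (fun i : Fin n => x i) = v :=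
  ⟨fun i => if hi : i < n then v ⟨i, hi⟩ else 0, by ext i; simp⟩

theorem bijective_act_of_isGraph {X Y : IF G H} {f : X ⟶ Y} [IsIso f]
    {A : Matrix (Fin Y.wires) (Fin X.wires) ℤ} (h : IsGraph f A) :
    Function.Bijective (A.mulVec) := by
  have h1 : ∀ x y, (∃ z, rel f x z ∧ rel (inv f) z y) ↔ ∀ i < X.wires, x i = y i := by
    intro x y
    rw [← rel_comp, IsIso.hom_inv_id, rel_id]
  have h2 : ∀ x y, (∃ z, rel (inv f) x z ∧ rel f z y) ↔ ∀ i < Y.wires, x i = y i := by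
    intro x y
    rw [← rel_comp, IsIso.inv_hom_id, rel_id]
  constructor
  · intro v w hvw
    obtain ⟨x, rfl⟩ := exists_label v
    obtain ⟨y, rfl⟩ := exists_label w
    obtain ⟨z, hz, hz'⟩ := (h1 y y).2 fun _ _ => rfl
    have hx : rel f x z := (h x z).2 (((h y z).1 hz).trans hvw.symm)
    exact funext fun i => (h1 x y).1 ⟨z, hx, hz'⟩ i i.2
  · intro w
    obtain ⟨y, rfl⟩ := exists_label w
    obtain ⟨z, -, hz⟩ := (h2 y y).2 fun _ _ => rfl
    exact ⟨_, ((h z y).1 hz).symm⟩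

theorem haOp_of_ha {X Y : IF G H} {f : X ⟶ Y} [IsIso f] (hf : HA f) : HAOp f := by
  obtain ⟨A, hA, hA'⟩ := exists_matrix hf
  have hbij := bijective_act_of_isGraph hA'
  obtain ⟨m⟩ := X
  obtain ⟨n⟩ := Y
  have e := LinearEquiv.ofBijective A.mulVecLin hbij
  obtain rfl : m = n := by simpa using e.finrank_eq
  have hu : IsUnit A := by
    rw [← Matrix.mulVec_surjective_iff_isUnit]
    exact hbij.2
  obtain ⟨g, hg, hgA⟩ := (generatingFamily_opMatrices G H).mem_of_isUnit hu
  exact hA.unique hgA ▸ hg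

/-! ### The dagger -/

theorem dagger_comp {X Y Z : IF G H} (f : X ⟶ Y) (g : Y ⟶ Z) :
    dagger (f ≫ g) = dagger g ≫ dagger f := by
  obtain ⟨f, rfl⟩ := eq_ofTerm f
  obtain ⟨g, rfl⟩ := eq_ofTerm g
  rfl

theorem dagger_tensor {m n m' n' : ℕ} (f : (⟨m⟩ : IF G H) ⟶ ⟨n⟩) (g : (⟨m'⟩ : IF G H) ⟶ ⟨n'⟩) :
    dagger (tensor f g) = tensor (dagger f) (dagger g) := by
  obtain ⟨f, rfl⟩ := ofTerm_surjective f
  obtain ⟨g, rfl⟩ := ofTerm_surjective g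
  rfl

theorem dagger_id (X : IF G H) : dagger (𝟙 X) = 𝟙 X := rfl

theorem term_dagger_dagger {m n : ℕ} (t : Term G H m n) : t.dagger.dagger = t := by
  induction t with
  | gen g => cases g <;> simp [Term.dagger, Gen.dagger]
  | idn n => rfl
  | swap m n => rfl
  | comp f g ihf ihg => simp [Term.dagger, ihf, ihg]
  | tensor f g ihf ihg => simp [Term.dagger, ihf, ihg]

theorem dagger_dagger {X Y : IF G H} (f : X ⟶ Y) : dagger (dagger f) = f := by
  obtain ⟨f, rfl⟩ := eq_ofTerm f
  exact congrArg ofTerm (term_dagger_dagger f)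

instance isIso_dagger {X Y : IF G H} (f : X ⟶ Y) [IsIso f] : IsIso (dagger f) :=
  ⟨dagger (inv f), by rw [← dagger_comp, IsIso.inv_hom_id, dagger_id],
    by rw [← dagger_comp, IsIso.hom_inv_id, dagger_id]⟩

theorem Generated.dagger {S T : MorphismProperty (IF G H)}
    (h : ∀ {X Y : IF G H} (f : X ⟶ Y), S f → T (IF.dagger f)) {X Y : IF G H} {f : X ⟶ Y}
    (hf : Generated S f) : Generated T (IF.dagger f) := by
  induction hf with
  | of f hf => exact Generated.of _ (h f hf)
  | id X => exact Generated.id X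
  | swap m n => exact Generated.swap n m
  | comp f g _ _ ihf ihg => exact dagger_comp f g ▸ Generated.comp _ _ ihg ihf
  | tensor f g _ _ ihf ihg => exact dagger_tensor f g ▸ Generated.tensor _ _ ihf ihg

theorem ha_dagger {X Y : IF G H} {f : X ⟶ Y} (hf : HAOp f) : HA (dagger f) := by
  refine Generated.dagger (fun {X Y} f hf => ?_) hf
  cases hf with
  | delta => exact HAGen.mu
  | eps => exact HAGen.eta
  | mu => exact HAGen.delta
  | eta => exact HAGen.eps
  | antipode => exact (dagger_dagger (ofTerm (Term.antipode : Term G H 1 1))).symm ▸ HAGen.antipode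

end IF

end InteractingFrobenius

theorem mainTheorem6 {G H : Type*} [CommGroup G] [CommGroup H]
    {X Y : InteractingFrobenius.IF G H} (f : X ⟶ Y) (hf : CategoryTheory.IsIso f) :
    InteractingFrobenius.IF.HA f ↔ InteractingFrobenius.IF.HAOp f := by
  open InteractingFrobenius.IF in
  refine ⟨haOp_of_ha, fun h => ?_⟩
  rw [← dagger_dagger f]
  exact ha_dagger (haOp_of_ha (ha_dagger h))
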